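/- Let $M$ be a smooth (Hausdorff) manifold with a sub-Lorentzian structure $(S,Q)$: $S\subseteq TM$ is a smooth distribution of constant rank and $Q_x$ is a smoothly varying nondegenerate symmetric bilinear form of index $1$ on $S_x$ (bracket generation is not needed, and $S=TM$, i.e. a Lorentz manifold, is allowed). Let $g_x\colon T^*_xM\to S_x$ be the cometric, defined by $Q_x(W,g_x\xi)=\langle W,\xi\rangle$ for all $W\in S_x$, and let $H(x,\xi)=\frac12\langle g_x\xi,\xi\rangle$. Biextremals are the solutions $(x(s),\xi(s))$ of the Hamiltonian equations $\dot x=\partial H/\partial\xi=g_x\xi$, $\dot\xi=-\partial H/\partial x$, and extremals are their projections to $M$. For $p\in M$ let $D_p\subseteq T_p^*M$ be the set of covectors $w$ for which the biextremal with $x_w(0)=p$, $\xi(0)=w$ exists on $[0,1]$, and put $\exp_p(w)=x_w(1)$ for $w\in D_p$. A vector $v\in S_x$ is timelike if $Q_x(v,v)<0$; a covector $\xi$ is timelike if $\langle g_x\xi,\xi\rangle<0$. A timelike curve $c\colon[a,b]\to M$, $a<b$, is a continuous, piecewise smooth curve whose (one-sided) velocities are all timelike (in particular horizontal) and which satisfies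 $Q(\dot c(t_i^-),\dot c(t_i^+))<0$ at each break $t_i$; its length is $L(c)=\int_a^b|Q(\dot c,\dot c)|^{1/2}\,ds$. An open set $U\ni p$ is called a normal neighborhood of $p$ if there is an open set $V\subseteq D_p$, star-shaped about $0\in V$, such that $\exp_p$ is smooth on $V$ and $\exp_p(V)\subseteq U$; at each timelike $v\in V$ the differential of $\exp_p$ is injective, and $\exp_p(w)=\exp_p(v)$ with $w\in V$ implies $w=v$; and every timelike curve $c\colon[a,b]\to U$ with $c(a)=p$ is of the form $c=\exp_p\circ w$ for some piecewise smooth $w\colon[a,b]\to V$ with $w(a)=0$. (If $S=TM$, this holds whenever $\exp_p\colon V\to U$ is a diffeomorphism taking $0$ to $p$, i.e. for the usual normal neighborhoods. If $S\neq TM$, then $\exp_p$ is not a diffeomorphism near $0$.) Let $U$ be a normal neighborhood of $p$, with $V$ as above, and suppose that there is a timelike curve in $U$ from $p$ to $q$. Then there is a unique $v\in V$ with $\exp_p(v)=q$, and the extremal segment $\sigma(s)=\exp_p(sv)$, $0\le s\le1$, from $p$ to $q$ is a timelike curve in $U$. It is the unique longest timelike curve in $U$ from $p$ to $q$: every timelike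 curve $\beta\colon[a,b]\to U$ from $p$ to $q$ satisfies $L(\beta)\le L(\sigma)$, and if $L(\beta)=L(\sigma)$, then $\beta=\sigma\circ h$ for a piecewise smooth, strictly increasing $h\colon[a,b]\to[0,1]$ with $h(a)=0$ and $h(b)=1$. -/

import Mathlib

open Set MeasureTheory
open scoped Manifold ContDiff

universe u v

noncomputable section

/-- The cotangent space at `x` of a manifold modelled on `E`. -/
abbrev CotangentSpace (E : Type u) [NormedAddCommGroup E] [NormedSpace ℝ E]
    {M : Type v} [TopologicalSpace M] [ChartedSpace E M] (x : M) : Type u :=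
  TangentSpace 𝓘(ℝ, E) x →L[ℝ] ℝ

/-- A sub-Lorentzian structure on a smooth manifold `M`: a smooth distribution `S` of constant
rank together with a smoothly varying nondegenerate symmetric bilinear form `Q x` of index `1` on
each fibre `S x`. Smoothness is expressed by smooth local frames of `S` in which the coefficients
of `Q` are smooth. Neither bracket generation nor `S ≠ TM` is imposed, so Lorentzian manifolds
are the case `S = TM`. -/
structure SubLorentzStructure (E : Type u) [NormedAddCommGroup E] [NormedSpace ℝ E]
    (M : Type v) [TopologicalSpace M] [ChartedSpace E M] [IsManifold 𝓘(ℝ, E) ∞ M] where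
  /-- the horizontal distribution -/
  S : ∀ x : M, Submodule ℝ (TangentSpace 𝓘(ℝ, E) x)
  /-- the metric on the horizontal distribution -/
  Q : ∀ x : M, LinearMap.BilinForm ℝ (S x)
  /-- the rank of the distribution -/
  rank : ℕ
  symm : ∀ x, (Q x).IsSymm
  nondegenerate : ∀ x, (Q x).Nondegenerate
  index_eq_one : ∀ x, IsGreatest
    {k : ℕ | ∃ W : Submodule ℝ (S x), Module.finrank ℝ W = k ∧ ∀ w ∈ W, w ≠ 0 → Q x w w < 0} 1
  exists_frame : ∀ x₀ : M, ∃ W : Set M, IsOpen W ∧ x₀ ∈ W ∧ ∃ X : Fin rank → ∀ x : M, S x,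
    (∀ i, ContMDiffOn 𝓘(ℝ, E) 𝓘(ℝ, E).tangent ∞
      (fun x => (⟨x, (X i x : TangentSpace 𝓘(ℝ, E) x)⟩ : TangentBundle 𝓘(ℝ, E) M)) W) ∧
    (∀ x ∈ W, LinearIndependent ℝ (fun i => X i x) ∧
      Submodule.span ℝ (range fun i => X i x) = ⊤) ∧
    (∀ i j, ContMDiffOn 𝓘(ℝ, E) 𝓘(ℝ, ℝ) ∞ (fun x => Q x (X i x) (X j x)) W)

/-- `t 0 < t 1 < ⋯ < t N` is a partition of `[a, b]`. -/
structure IsPartition (t : ℕ → ℝ) (N : ℕ) (a b : ℝ) : Prop where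
  left : t 0 = a
  right : t N = b
  lt : ∀ i < N, t i < t (i + 1)

/-- Piecewise smooth maps from `[a, b]` to a normed space. -/
def IsPiecewiseSmooth {F : Type u} [NormedAddCommGroup F] [NormedSpace ℝ F]
    (w : ℝ → F) (a b : ℝ) : Prop :=
  ∃ (N : ℕ) (t : ℕ → ℝ), IsPartition t N a b ∧
    ∀ i < N, ContDiffOn ℝ ∞ w (Icc (t i) (t (i + 1)))

/-- The velocity `ċ(s)` of a curve `c`, relative to the parameter set `J`; at an end point of an
interval `J` this is the one-sided velocity. -/
def velocityWithin (E : Type u) [NormedAddCommGroup E] [NormedSpace ℝ E]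
    {M : Type v} [TopologicalSpace M] [ChartedSpace E M]
    (c : ℝ → M) (J : Set ℝ) (s : ℝ) : TangentSpace 𝓘(ℝ, E) (c s) :=
  mfderivWithin 𝓘(ℝ, ℝ) 𝓘(ℝ, E) c J s (1 : ℝ)

namespace SubLorentzStructure

variable {E : Type u} [NormedAddCommGroup E] [NormedSpace ℝ E] [FiniteDimensional ℝ E]
  {M : Type v} [TopologicalSpace M] [ChartedSpace E M] [IsManifold 𝓘(ℝ, E) ∞ M]

instance instFiniteDimensionalTangent (x : M) :
    FiniteDimensional ℝ (TangentSpace 𝓘(ℝ, E) x) :=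
  inferInstanceAs (FiniteDimensional ℝ E)

/-! ### The cometric and its Hamiltonian -/

/-- The cometric `g x : T*ₓM → S x`, characterized by `Q x (W, g x ξ) = ⟨W, ξ⟩` for `W ∈ S x`. -/
def cometric (G : SubLorentzStructure E M) (x : M) (ξ : CotangentSpace E x) : G.S x :=
  ((G.Q x).toDual (G.nondegenerate x)).symm
    ((ξ : TangentSpace 𝓘(ℝ, E) x →ₗ[ℝ] ℝ).domRestrict (G.S x))

theorem Q_cometric (G : SubLorentzStructure E M) (x : M) (ξ : CotangentSpace E x) (W : G.S x) :
    G.Q x W (G.cometric x ξ) = ξ (W : TangentSpace 𝓘(ℝ, E) x) := by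
  rw [← (G.symm x).eq]
  exact LinearMap.BilinForm.apply_toDual_symm_apply _ _

/-- The Hamiltonian `H(x, ξ) = ½ ⟨g x ξ, ξ⟩`. -/
def hamiltonian (G : SubLorentzStructure E M) (x : M) (ξ : CotangentSpace E x) : ℝ :=
  (1 / 2) * ξ (G.cometric x ξ : TangentSpace 𝓘(ℝ, E) x)

/-- A covector is timelike if `⟨g x ξ, ξ⟩ < 0`. -/
def TimelikeCovector (G : SubLorentzStructure E M) (x : M) (ξ : CotangentSpace E x) : Prop :=
  ξ (G.cometric x ξ : TangentSpace 𝓘(ℝ, E) x) < 0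

/-- The Hamiltonian in the chart at `x₀`, as a function of the position `y` in the chart and of
the components `η` of the covector. The trivialization of `TM` at `x₀` is, at each point of the
chart domain, the differential of the chart, so that the covector with components `η` is
`η ∘ dφ`. -/
def chartHamiltonian (G : SubLorentzStructure E M) (x₀ : M) (y : E) (η : E →L[ℝ] ℝ) : ℝ :=
  G.hamiltonian ((extChartAt 𝓘(ℝ, E) x₀).symm y)
    (η ∘L (trivializationAt E (TangentSpace 𝓘(ℝ, E)) x₀).continuousLinearMapAt ℝ
      ((extChartAt 𝓘(ℝ, E) x₀).symm y))

/-- A curve `Γ = (x, ξ)` in the cotangent bundle is a biextremal on `[a, b]` if it satisfies the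
Hamiltonian equations `ẋ = g(x) ξ`, `ξ̇ = -∂H/∂x` in the charts of `M` (with one-sided
derivatives at the end points). -/
def IsBiextremalOn (G : SubLorentzStructure E M)
    (Γ : ℝ → Σ x : M, CotangentSpace E x) (a b : ℝ) : Prop :=
  ContinuousOn (fun s => (Γ s).1) (Icc a b) ∧
  ∀ s₀ ∈ Icc a b, ∀ x₀ : M, (Γ s₀).1 ∈ (chartAt E x₀).source →
    HasDerivWithinAt (fun s => extChartAt 𝓘(ℝ, E) x₀ (Γ s).1)
      ((trivializationAt E (TangentSpace 𝓘(ℝ, E)) x₀).continuousLinearMapAt ℝ (Γ s₀).1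
        (G.cometric (Γ s₀).1 (Γ s₀).2 : TangentSpace 𝓘(ℝ, E) (Γ s₀).1))
      (Icc a b) s₀ ∧
    HasDerivWithinAt
      (fun s => (Γ s).2 ∘L (trivializationAt E (TangentSpace 𝓘(ℝ, E)) x₀).symmL ℝ (Γ s).1)
      (-fderiv ℝ
        (fun y => G.chartHamiltonian x₀ y
          ((Γ s₀).2 ∘L
            (trivializationAt E (TangentSpace 𝓘(ℝ, E)) x₀).symmL ℝ (Γ s₀).1))
        (extChartAt 𝓘(ℝ, E) x₀ (Γ s₀).1))
      (Icc a b) s₀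

/-! ### The exponential map

`TangentSpace 𝓘(ℝ, E) p` is by definition the vector space `E`. Where the smooth structure of
the vector space `T*ₚM` is used, the latter is written as the normed space `E →L[ℝ] ℝ`. -/

/-- The set `Dₚ` of covectors `w` at `p` whose extremal is defined on `[0, 1]`. -/
def expDomain (G : SubLorentzStructure E M) (p : M) : Set (E →L[ℝ] ℝ) :=
  {w | ∃ Γ : ℝ → Σ x : M, CotangentSpace E x, G.IsBiextremalOn Γ 0 1 ∧ Γ 0 = ⟨p, w⟩}

open Classical in
/-- The exponential map `expₚ w = x_w(1)`, with the (irrelevant) value `p` outside `Dₚ`. -/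
def exp (G : SubLorentzStructure E M) (p : M) (w : E →L[ℝ] ℝ) : M :=
  if h : w ∈ G.expDomain p then (Classical.choose h 1).1 else p

/-! ### Timelike curves and their length -/

open Classical in
/-- The number `Q x (v, w)` for `v, w ∈ S x`, with the value `0` if `v` or `w` is not
horizontal. -/
def pairing (G : SubLorentzStructure E M) (x : M) (v w : TangentSpace 𝓘(ℝ, E) x) : ℝ :=
  if h : v ∈ G.S x ∧ w ∈ G.S x then G.Q x ⟨v, h.1⟩ ⟨w, h.2⟩ else 0

/-- A tangent vector is timelike if it is horizontal and `Q x (v, v) < 0`. -/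
def TimelikeVector (G : SubLorentzStructure E M) (x : M) (v : TangentSpace 𝓘(ℝ, E) x) : Prop :=
  v ∈ G.S x ∧ G.pairing x v v < 0

/-- Piecewise smooth timelike curves `c : [a, b] → M`: the curve is smooth with timelike velocity
on each closed interval of a partition, and `Q(ċ(tᵢ⁻), ċ(tᵢ⁺)) < 0` at each break `tᵢ`, so that
the timecone does not change there. -/
def IsTimelikeCurve (G : SubLorentzStructure E M) (c : ℝ → M) (a b : ℝ) : Prop :=
  a < b ∧ ∃ (N : ℕ) (t : ℕ → ℝ), IsPartition t N a b ∧
    (∀ i < N, ContMDiffOn 𝓘(ℝ, ℝ) 𝓘(ℝ, E) ∞ c (Icc (t i) (t (i + 1))) ∧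
      ∀ s ∈ Icc (t i) (t (i + 1)),
        G.TimelikeVector (c s) (velocityWithin E c (Icc (t i) (t (i + 1))) s)) ∧
    (∀ i, i + 1 < N →
      G.pairing (c (t (i + 1)))
        (velocityWithin E c (Icc (t i) (t (i + 1))) (t (i + 1)))
        (velocityWithin E c (Icc (t (i + 1)) (t (i + 2))) (t (i + 1))) < 0)

/-- A piecewise smooth timelike curve `c : [a, b] → U` from `p` to `q`. -/
structure IsTimelikeCurveIn (G : SubLorentzStructure E M) (U : Set M) (p q : M)
    (c : ℝ → M) (a b : ℝ) : Prop where
  timelike : G.IsTimelikeCurve c a b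
  mapsTo : MapsTo c (Icc a b) U
  source : c a = p
  target : c b = q

/-- The length (natural parameter) `L(c) = ∫ₐᵇ |Q(ċ, ċ)|^{1/2} ds`. -/
def length (G : SubLorentzStructure E M) (c : ℝ → M) (a b : ℝ) : ℝ :=
  ∫ s in a..b, Real.sqrt |G.pairing (c s) (velocityWithin E c univ s) (velocityWithin E c univ s)|

/-! ### Normal neighbourhoods -/

/-- `U` is a normal neighbourhood of `p`, with `V ⊆ T*ₚM` as the corresponding neighbourhood of the
origin.

If `S = TM`, every open `U` that is the diffeomorphic image under `expₚ` of a star-shaped open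
neighbourhood `V` of the origin is of this kind (see `IsNormalNeighborhood.of_diffeomorphic`).
If `S ≠ TM`, then `expₚ` collapses the annihilator of `S p` to the point `p`, and no neighbourhood of
the origin is mapped diffeomorphically. In that case only the timelike covectors are asked to be
mapped injectively and immersively, without further preimages of their images in `V`, and only
the timelike curves from `p` are asked to be images of curves in `V` from the origin. Nothing is
required of the causal character of such a lift. -/
structure IsNormalNeighborhood (G : SubLorentzStructure E M) (p : M)
    (V : Set (E →L[ℝ] ℝ)) (U : Set M) : Prop where
  isOpen : IsOpen U
  mem : p ∈ U
  isOpen_covectors : IsOpen V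
  zero_mem : (0 : E →L[ℝ] ℝ) ∈ V
  starConvex : StarConvex ℝ 0 V
  subset_expDomain : V ⊆ G.expDomain p
  mapsTo : MapsTo (G.exp p) V U
  smooth : ContMDiffOn 𝓘(ℝ, E →L[ℝ] ℝ) 𝓘(ℝ, E) ∞ (G.exp p) V
  injective : ∀ v ∈ V, G.TimelikeCovector p v → ∀ w ∈ V, G.exp p w = G.exp p v → w = v
  immersive : ∀ v ∈ V, G.TimelikeCovector p v →
    Function.Injective (mfderiv 𝓘(ℝ, E →L[ℝ] ℝ) 𝓘(ℝ, E) (G.exp p) v)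
  exists_lift : ∀ (c : ℝ → M) (a b : ℝ), G.IsTimelikeCurve c a b → MapsTo c (Icc a b) U →
    c a = p → ∃ w : ℝ → (E →L[ℝ] ℝ), IsPiecewiseSmooth w a b ∧ w a = 0 ∧
      ∀ s ∈ Icc a b, w s ∈ V ∧ G.exp p (w s) = c s

/-- Normal neighbourhoods in the sense of semi-Riemannian geometry are normal neighbourhoods. -/
theorem IsNormalNeighborhood.of_diffeomorphic (G : SubLorentzStructure E M) (p : M)
    (V : Set (E →L[ℝ] ℝ)) (U : Set M) (hU : IsOpen U) (hp : p ∈ U) (hV : IsOpen V)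
    (h0 : (0 : E →L[ℝ] ℝ) ∈ V) (hs : StarConvex ℝ 0 V) (hD : V ⊆ G.expDomain p)
    (hm : MapsTo (G.exp p) V U) (he : ContMDiffOn 𝓘(ℝ, E →L[ℝ] ℝ) 𝓘(ℝ, E) ∞ (G.exp p) V)
    (log : M → (E →L[ℝ] ℝ)) (hlog : ContMDiffOn 𝓘(ℝ, E) 𝓘(ℝ, E →L[ℝ] ℝ) ∞ log U)
    (hlm : MapsTo log U V) (hle : ∀ v ∈ V, log (G.exp p v) = v)
    (hel : ∀ x ∈ U, G.exp p (log x) = x) (hlp : log p = 0) :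
    G.IsNormalNeighborhood p V U where
  isOpen := hU
  mem := hp
  isOpen_covectors := hV
  zero_mem := h0
  starConvex := hs
  subset_expDomain := hD
  mapsTo := hm
  smooth := he
  injective v hv _ w hw h := by rw [← hle w hw, h, hle v hv]
  immersive v hv _ := by
    have h1 : MDifferentiableAt 𝓘(ℝ, E →L[ℝ] ℝ) 𝓘(ℝ, E) (G.exp p) v :=
      (he.contMDiffAt (hV.mem_nhds hv)).mdifferentiableAt (by simp)
    have h2 : MDifferentiableAt 𝓘(ℝ, E) 𝓘(ℝ, E →L[ℝ] ℝ) log (G.exp p v) :=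
      (hlog.contMDiffAt (hU.mem_nhds (hm hv))).mdifferentiableAt (by simp)
    have h3 : HasMFDerivAt 𝓘(ℝ, E →L[ℝ] ℝ) 𝓘(ℝ, E →L[ℝ] ℝ) (log ∘ G.exp p) v _ :=
      h2.hasMFDerivAt.comp v h1.hasMFDerivAt
    have h4 : log ∘ G.exp p =ᶠ[nhds v] id :=
      Filter.eventuallyEq_of_mem (hV.mem_nhds hv) hle
    have h5 := hasMFDerivAt_unique h3 ((hasMFDerivAt_id v).congr_of_eventuallyEq h4)
    intro x y hxy
    have h6 := congrArg (fun A => A x) h5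
    have h7 := congrArg (fun A => A y) h5
    exact h6.symm.trans ((congrArg (mfderiv 𝓘(ℝ, E) 𝓘(ℝ, E →L[ℝ] ℝ) log (G.exp p v)) hxy).trans h7)
  exists_lift c a b hc hcU hca := by
    obtain ⟨-, N, t, ht, hsm, -⟩ := hc
    refine ⟨fun s => log (c s), ⟨N, t, ht, fun i hi => ?_⟩, by simp [hca, hlp], fun s hs =>
      ⟨hlm (hcU hs), hel _ (hcU hs)⟩⟩
    have hmono : ∀ j, ∀ k, j + k ≤ N → t j ≤ t (j + k) := by
      intro j k
      induction k with
      | zero => intro _; exact le_rfl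
      | succ k ih => intro h; exact (ih (by omega)).trans (ht.lt (j + k) (by omega)).le
    have hsub : Icc (t i) (t (i + 1)) ⊆ Icc a b := by
      refine Icc_subset_Icc ?_ ?_
      · have := hmono 0 i (by omega)
        rwa [ht.left, zero_add] at this
      · have := hmono (i + 1) (N - (i + 1)) (by omega)
        rwa [show i + 1 + (N - (i + 1)) = N by omega, ht.right] at this
    exact contMDiffOn_iff_contDiffOn.1 (hlog.comp (hsm i hi).1 fun s hs => hcU (hsub hs))

end SubLorentzStructure

end

/-! A timelike curve c in U from p lifts to a curve w in V from 0, and its length is controlled by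
the radius r(z) = (-⟨g_p z, z⟩)^{1/2} of the lift. The Gauss lemma (`gauss`, `exists_radial`) states
that Q(dexp_z u, dexp_z z) = ⟨u, g_p z⟩ whenever dexp_z u is horizontal. With z = w and u = w', the
reverse Cauchy-Schwarz inequality for forms of index one gives |Q(ċ, ċ)|^{1/2} ≤ -⟨w', g_p w⟩ / r(w)
= (r ∘ w)'. Integration yields L(c) ≤ r(w(b)). If c ends at q, then w(b) = v, and r(v) is the length
of σ because the energy is conserved along extremals. In the case of equality, the two integrands
agree almost everywhere. The equality case of reverse Cauchy-Schwarz makes ċ proportional to the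
radial velocity, and immersivity of exp at timelike covectors makes w' proportional to w. Hence w /
r(w) is constant and c runs along σ with parameter r(w) / r(v).

Two points go beyond the Lorentzian argument. For S ≠ TM a velocity does not determine its momentum,
so the Gauss lemma is proved for the momentum ξ: along the radial extremal of w, the pairing of ξ(s)
with dexp_{sw}(sη) has constant derivative ⟨η, g_p w⟩ (`hasDerivWithinAt_momentum_dexp`). Moreover
nothing is assumed about the causal character of w, so `IsTimelikeLift.neg` shows by induction along
the interval that w stays in one timecone: it enters the cone with timelike initial velocity, and
⟨w', g_p w⟩ < 0 persists because two timelike vectors are never orthogonal and the timecone of ċ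
does not change at a break. -/

open Filter Topology

set_option linter.unusedSectionVars false

noncomputable section

/-! ### Symmetric bilinear forms of index one -/

section IndexOne

variable {W : Type*} [AddCommGroup W] [Module ℝ W] {B : LinearMap.BilinForm ℝ W}

/-- For a form of index at most one, the orthogonal complement of a timelike vector is
positive semidefinite. -/
theorem nonneg_of_orthogonal_timelike (hs : B.IsSymm)
    (hB : ∀ k ∈ {k : ℕ | ∃ Z : Submodule ℝ W, Module.finrank ℝ Z = k ∧
      ∀ w ∈ Z, w ≠ 0 → B w w < 0}, k ≤ 1)
    {u y : W} (hu : B u u < 0) (huy : B u y = 0) : 0 ≤ B y y := by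
  by_contra! hy
  have hyu : B y u = 0 := by rw [hs.eq]; exact huy
  have hli : LinearIndependent ℝ ![u, y] := by
    rw [LinearIndependent.pair_iff]
    intro s t h
    have h1 : B u (s • u + t • y) = 0 := by rw [h]; simp
    have h2 : B y (s • u + t • y) = 0 := by rw [h]; simp
    simp only [map_add, map_smul, smul_eq_mul, huy, hyu, mul_zero, add_zero, zero_add,
      mul_eq_zero] at h1 h2
    exact ⟨h1.resolve_right hu.ne, h2.resolve_right hy.ne⟩
  have h2 : Module.finrank ℝ (Submodule.span ℝ (range ![u, y])) = 2 := by
    simpa using finrank_span_eq_card hli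
  have := hB 2 ⟨_, h2, fun w hw hw0 => by
    rw [Matrix.range_cons, Matrix.range_cons, Matrix.range_empty, union_empty,
      singleton_union, Submodule.mem_span_pair] at hw
    obtain ⟨s, t, rfl⟩ := hw
    have hst : s ≠ 0 ∨ t ≠ 0 := by
      by_contra! h
      exact hw0 (by simp [h.1, h.2])
    have e : B (s • u + t • y) (s • u + t • y) = s ^ 2 * B u u + t ^ 2 * B y y := by
      simp [huy, hyu]; ring
    rw [e]
    rcases hst with h | h
    · nlinarith [pow_pos (abs_pos.2 h) 2, sq_abs s, sq_nonneg t]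
    · nlinarith [pow_pos (abs_pos.2 h) 2, sq_abs t, sq_nonneg s]⟩
  omega

/-- The vector B(u,u) y - B(u,y) u is orthogonal to u, so its square is nonnegative. That square is
B(u,u) times the Gram determinant of u and y, and B(u,u) < 0 reverses the sign. -/
theorem reverse_cauchySchwarz (hs : B.IsSymm)
    (hB : ∀ u y : W, B u u < 0 → B u y = 0 → 0 ≤ B y y)
    {u : W} (y : W) (hu : B u u < 0) : B u u * B y y ≤ B u y ^ 2 := by
  have h := hB u (B u u • y - B u y • u) hu (by simp; ring)
  have e : B (B u u • y - B u y • u) (B u u • y - B u y • u) =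
      B u u * (B u u * B y y - B u y ^ 2) := by
    simp [hs.eq y u]; ring
  rw [e] at h
  nlinarith

/-- Equality makes the component z of y orthogonal to u a null vector. On the complement of u the
form is semidefinite, so a null vector there is orthogonal to the whole complement, and to u as
well; nondegeneracy gives z = 0. -/
theorem eq_smul_of_reverse_cauchySchwarz_eq (hs : B.IsSymm) (hn : B.Nondegenerate)
    (hB : ∀ u y : W, B u u < 0 → B u y = 0 → 0 ≤ B y y)
    {u y : W} (hu : B u u < 0) (h : B u u * B y y = B u y ^ 2) : y = (B u y / B u u) • u := by
  set z := y - (B u y / B u u) • u with hz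
  have hne := hu.ne
  have hz1 : B u z = 0 := by simp [hz, hne]
  have hz2 : B z z = 0 := by
    have e : B z z = B y z - B u y / B u u * B u z := by
      conv_lhs => rw [hz]
      simp only [map_sub, map_smul, LinearMap.sub_apply, LinearMap.smul_apply, smul_eq_mul]
      rw [hz]
      simp only [map_sub, map_smul, smul_eq_mul, hs.eq y u]
    rw [e, hz1, mul_zero, sub_zero, hz]
    simp only [map_sub, map_smul, smul_eq_mul, hs.eq y u]
    field_simp
    linarith
  have hz3 : ∀ x, B u x = 0 → B x z = 0 := by
    intro x hx
    have key : ∀ t : ℝ, 0 ≤ B x x + 2 * t * B x z := by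
      intro t
      have := hB u (x + t • z) hu (by simp [hx, hz1])
      simp [hz2, hs.eq z x] at this
      linarith
    by_contra hne
    -- At this t the affine function in `key` takes the value -1.
    have := key (-(B x x + 1) / (2 * B x z))
    field_simp at this
    nlinarith
  have hz4 : ∀ x, B x z = 0 := by
    intro x
    have := hz3 (x - (B u x / B u u) • u) (by simp [hne])
    simpa [hz1] using this
  have : z = 0 := hn.2 z hz4
  rw [hz] at this
  exact sub_eq_zero.1 this

theorem ne_zero_of_timelike (hB : ∀ u y : W, B u u < 0 → B u y = 0 → 0 ≤ B y y)
    {u y : W} (hu : B u u < 0) (hy : B y y < 0) : B u y ≠ 0 :=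
  fun h => (hB u y hu h).not_gt hy

/-- Being in the same timecone is a transitive relation. -/
theorem timecone_trans (hs : B.IsSymm)
    (hB : ∀ u y : W, B u u < 0 → B u y = 0 → 0 ≤ B y y)
    {u y z : W} (hu : B u u < 0) (hy : B y y < 0) (hz : B z z < 0)
    (h1 : B u y < 0) (h2 : B y z < 0) : B u z < 0 := by
  by_contra! h
  -- This combination is orthogonal to the timelike y, so its square is nonnegative; if B(u,z) ≥ 0,
  -- the expansion below would make it negative.
  have := hB y (B y z • u - B u y • z) hy (by simp [hs.eq y u]; ring)
  have e : B (B y z • u - B u y • z) (B y z • u - B u y • z) =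
      B y z ^ 2 * B u u - 2 * (B y z * B u y) * B u z + B u y ^ 2 * B z z := by
    simp [hs.eq z u]; ring
  rw [e] at this
  have a1 : 0 < B y z * B u y := mul_pos_of_neg_of_neg h2 h1
  have a2 : B y z ^ 2 * B u u < 0 := mul_neg_of_pos_of_neg (sq_pos_of_neg h2) hu
  have a3 : B u y ^ 2 * B z z < 0 := mul_neg_of_pos_of_neg (sq_pos_of_neg h1) hz
  nlinarith [mul_nonneg a1.le h]

end IndexOne

/-! ### Induction along an interval -/

/-- The infimum of the counterexamples satisfies P by `hl` (or `h0`), and then `hr` pushes P past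
it. -/
theorem Icc_induction {a b : ℝ} {P : ℝ → Prop} (h0 : P a)
    (hr : ∀ x ∈ Ico a b, P x → ∀ᶠ y in 𝓝[>] x, P y)
    (hl : ∀ x ∈ Ioc a b, (∀ y ∈ Ico a x, P y) → P x) : ∀ x ∈ Icc a b, P x := by
  by_contra! h
  obtain ⟨x, hx, hxP⟩ := h
  set S := {y | y ∈ Icc a b ∧ ¬ P y} with hS
  have hSne : S.Nonempty := ⟨x, hx, hxP⟩
  have hSb : BddBelow S := ⟨a, fun y hy => hy.1.1⟩
  set m := sInf S with hm
  have ham : a ≤ m := le_csInf hSne fun y hy => hy.1.1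
  have hmx : m ≤ x := csInf_le hSb ⟨hx, hxP⟩
  have hlt : ∀ y ∈ Ico a m, P y := by
    intro y hy
    by_contra hc
    exact absurd (csInf_le hSb ⟨⟨hy.1, (hy.2.le.trans hmx).trans hx.2⟩, hc⟩) (not_le.2 hy.2)
  have hPm : P m := by
    rcases ham.eq_or_lt with h | h
    · rwa [← h]
    · exact hl m ⟨h, hmx.trans hx.2⟩ hlt
  have hmb : m < x := hmx.lt_of_ne fun h => hxP (h ▸ hPm)
  have hev := hr m ⟨ham, hmb.trans_le hx.2⟩ hPm
  obtain ⟨d, hd, hd'⟩ := (mem_nhdsGT_iff_exists_Ioo_subset.1 hev)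
  obtain ⟨y, hy, hyd⟩ := exists_lt_of_csInf_lt hSne (show sInf S < d from hd)
  rcases (csInf_le hSb hy).eq_or_lt with h | h
  · exact hy.2 (h ▸ hPm)
  · exact hy.2 (hd' ⟨h, hyd⟩)

namespace SubLorentzStructure

variable {E : Type u} [NormedAddCommGroup E] [NormedSpace ℝ E] [FiniteDimensional ℝ E]
  {M : Type v} [TopologicalSpace M] [ChartedSpace E M] [IsManifold 𝓘(ℝ, E) ∞ M]

/-! ### The cometric in a chart -/

theorem orthogonal_nonneg (G : SubLorentzStructure E M) (x : M) (u y : G.S x)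
    (hu : G.Q x u u < 0) (huy : G.Q x u y = 0) : 0 ≤ G.Q x y y :=
  nonneg_of_orthogonal_timelike (G.symm x) (G.index_eq_one x).2 hu huy

theorem cometric_eq_of_forall (G : SubLorentzStructure E M) (x : M) (ξ : CotangentSpace E x)
    (u : G.S x) (h : ∀ W : G.S x, G.Q x W u = ξ (W : TangentSpace 𝓘(ℝ, E) x)) :
    G.cometric x ξ = u := by
  rw [← sub_eq_zero]
  refine (G.nondegenerate x).2 _ fun W => ?_
  rw [map_sub, Q_cometric, h, sub_self]

theorem cometric_add (G : SubLorentzStructure E M) (x : M) (ξ ζ : CotangentSpace E x) :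
    G.cometric x (ξ + ζ) = G.cometric x ξ + G.cometric x ζ :=
  G.cometric_eq_of_forall x _ _ fun W => by simp [Q_cometric]

theorem cometric_smul (G : SubLorentzStructure E M) (x : M) (r : ℝ) (ξ : CotangentSpace E x) :
    G.cometric x (r • ξ) = r • G.cometric x ξ :=
  G.cometric_eq_of_forall x _ _ fun W => by simp [Q_cometric]

theorem apply_cometric_comm (G : SubLorentzStructure E M) (x : M) (ξ ζ : CotangentSpace E x) :
    ξ (G.cometric x ζ : TangentSpace 𝓘(ℝ, E) x) = ζ (G.cometric x ξ : TangentSpace 𝓘(ℝ, E) x) := by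
  rw [← Q_cometric, ← Q_cometric, (G.symm x).eq]

theorem Q_cometric_cometric (G : SubLorentzStructure E M) (x : M) (ξ : CotangentSpace E x) :
    G.Q x (G.cometric x ξ) (G.cometric x ξ) = ξ (G.cometric x ξ : TangentSpace 𝓘(ℝ, E) x) :=
  G.Q_cometric x ξ _

/-- The differential of the chart at `x₀`, as a trivialization of the tangent bundle. -/
abbrev toChart (x₀ x : M) : TangentSpace 𝓘(ℝ, E) x →L[ℝ] E :=
  (trivializationAt E (TangentSpace 𝓘(ℝ, E)) x₀).continuousLinearMapAt ℝ x

/-- The inverse of the differential of the chart at `x₀`. -/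
abbrev ofChart (x₀ x : M) : E →L[ℝ] TangentSpace 𝓘(ℝ, E) x :=
  (trivializationAt E (TangentSpace 𝓘(ℝ, E)) x₀).symmL ℝ x

theorem ofChart_toChart {x₀ x : M} (hx : x ∈ (chartAt E x₀).source)
    (v : TangentSpace 𝓘(ℝ, E) x) : ofChart x₀ x (toChart x₀ x v) = v :=
  Bundle.Trivialization.symmL_continuousLinearMapAt _ (by simpa using hx) v

/-- The cometric in the chart at `x₀`. -/
def chartCometric (G : SubLorentzStructure E M) (x₀ : M) (y : E) (η : E →L[ℝ] ℝ) : E :=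
  toChart x₀ ((extChartAt 𝓘(ℝ, E) x₀).symm y)
    (G.cometric ((extChartAt 𝓘(ℝ, E) x₀).symm y)
      (η ∘L toChart x₀ ((extChartAt 𝓘(ℝ, E) x₀).symm y)) : TangentSpace 𝓘(ℝ, E) _)

theorem chartHamiltonian_eq (G : SubLorentzStructure E M) (x₀ : M) (y : E) (η : E →L[ℝ] ℝ) :
    G.chartHamiltonian x₀ y η = (1 / 2) * η (G.chartCometric x₀ y η) := rfl

theorem chartCometric_add (G : SubLorentzStructure E M) (x₀ : M) (y : E) (η ζ : E →L[ℝ] ℝ) :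
    G.chartCometric x₀ y (η + ζ) = G.chartCometric x₀ y η + G.chartCometric x₀ y ζ := by
  simp only [chartCometric, ContinuousLinearMap.add_comp, cometric_add, Submodule.coe_add, map_add]

theorem chartCometric_smul (G : SubLorentzStructure E M) (x₀ : M) (y : E) (r : ℝ)
    (η : E →L[ℝ] ℝ) : G.chartCometric x₀ y (r • η) = r • G.chartCometric x₀ y η := by
  simp only [chartCometric, ContinuousLinearMap.smul_comp, cometric_smul, Submodule.coe_smul,
    map_smul]

theorem apply_chartCometric_comm (G : SubLorentzStructure E M) (x₀ : M) (y : E)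
    (η ζ : E →L[ℝ] ℝ) : η (G.chartCometric x₀ y ζ) = ζ (G.chartCometric x₀ y η) :=
  G.apply_cometric_comm ((extChartAt 𝓘(ℝ, E) x₀).symm y)
    (η ∘L toChart x₀ ((extChartAt 𝓘(ℝ, E) x₀).symm y))
    (ζ ∘L toChart x₀ ((extChartAt 𝓘(ℝ, E) x₀).symm y))

theorem chartCometric_extChartAt (G : SubLorentzStructure E M) {x₀ x : M}
    (hx : x ∈ (chartAt E x₀).source) (ξ : CotangentSpace E x) :
    G.chartCometric x₀ (extChartAt 𝓘(ℝ, E) x₀ x) (ξ ∘L ofChart x₀ x) =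
      toChart x₀ x (G.cometric x ξ : TangentSpace 𝓘(ℝ, E) x) := by
  have h : (extChartAt 𝓘(ℝ, E) x₀).symm (extChartAt 𝓘(ℝ, E) x₀ x) = x :=
    (extChartAt 𝓘(ℝ, E) x₀).left_inv (by simpa using hx)
  unfold chartCometric
  rw [h]
  congr 3
  ext v
  exact congrArg ξ (ofChart_toChart hx v)

/-! ### The cometric in a smooth frame -/

section Frame

variable (G : SubLorentzStructure E M) {x : M} {X : Fin G.rank → G.S x}

/-- The Gram matrix of a frame. -/
def gram (X : Fin G.rank → G.S x) : Matrix (Fin G.rank) (Fin G.rank) ℝ :=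
  Matrix.of fun i j => G.Q x (X i) (X j)

theorem eq_zero_of_orthogonal_frame (hspan : Submodule.span ℝ (range X) = ⊤) (u : G.S x)
    (h : ∀ k, G.Q x (X k) u = 0) : u = 0 := by
  refine (G.nondegenerate x).2 _ fun W => ?_
  have hW : W ∈ Submodule.span ℝ (range X) := by rw [hspan]; trivial
  induction hW using Submodule.span_induction with
  | mem w hw => obtain ⟨k, rfl⟩ := hw; exact h k
  | zero => simp
  | add a b _ _ ha hb => simp [ha, hb]
  | smul r a _ ha => simp [ha]

theorem det_gram_ne_zero (hli : LinearIndependent ℝ X)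
    (hspan : Submodule.span ℝ (range X) = ⊤) : (G.gram X).det ≠ 0 := by
  intro hdet
  obtain ⟨v, hv, hv0⟩ := Matrix.exists_mulVec_eq_zero_iff.2 hdet
  refine hv (funext fun i => ?_)
  refine Fintype.linearIndependent_iff.1 hli v ?_ i
  refine G.eq_zero_of_orthogonal_frame hspan _ fun k => ?_
  have := congrFun hv0 k
  simpa [Matrix.mulVec, dotProduct, gram, mul_comm] using this

/-- Cramer's rule for the Gram matrix. The determinant and adjugate exhibit the coefficients as
rational functions of smooth data, from which smoothness of the cometric follows. -/
theorem cometric_eq_frame (hli : LinearIndependent ℝ X)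
    (hspan : Submodule.span ℝ (range X) = ⊤) (ξ : CotangentSpace E x) :
    G.cometric x ξ = ∑ i, (((G.gram X).det)⁻¹ * ∑ j, (G.gram X).adjugate i j *
      ξ (X j : TangentSpace 𝓘(ℝ, E) x)) • X i := by
  rw [← sub_eq_zero]
  refine G.eq_zero_of_orthogonal_frame hspan _ fun k => ?_
  have h := congrFun (congrArg (fun A => A.mulVec fun j => ξ (X j : TangentSpace 𝓘(ℝ, E) x))
    (Matrix.mul_adjugate (G.gram X))) k
  rw [← Matrix.mulVec_mulVec, Matrix.smul_mulVec, Matrix.one_mulVec] at h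
  have h2 : G.Q x (X k) (∑ i, (((G.gram X).det)⁻¹ * ∑ j, (G.gram X).adjugate i j *
      ξ (X j : TangentSpace 𝓘(ℝ, E) x)) • X i) =
      ((G.gram X).det)⁻¹ * ((G.gram X).mulVec ((G.gram X).adjugate.mulVec
        fun j => ξ (X j : TangentSpace 𝓘(ℝ, E) x))) k := by
    simp only [map_sum, map_smul, smul_eq_mul, Matrix.mulVec, dotProduct, Finset.mul_sum]
    refine Finset.sum_congr rfl fun i _ => ?_
    rw [← Finset.mul_sum, ← Finset.mul_sum]
    simp only [gram, Matrix.of_apply, ← Finset.mul_sum]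
    ring
  rw [map_sub, Q_cometric, h2, h, Pi.smul_apply, smul_eq_mul,
    inv_mul_cancel_left₀ (G.det_gram_ne_zero hli hspan), sub_self]

end Frame

theorem contDiffAt_det {F : Type*} [NormedAddCommGroup F] [NormedSpace ℝ F] {ι : Type*}
    [Fintype ι] [DecidableEq ι] {n : ℕ∞ω} {A : F → Matrix ι ι ℝ} {y : F}
    (h : ∀ i j, ContDiffAt ℝ n (fun z => A z i j) y) : ContDiffAt ℝ n (fun z => (A z).det) y := by
  simp only [Matrix.det_apply]
  exact ContDiffAt.sum fun σ _ => (contDiffAt_prod fun i _ => h _ _).const_smul _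

theorem contDiffAt_adjugate {F : Type*} [NormedAddCommGroup F] [NormedSpace ℝ F] {ι : Type*}
    [Fintype ι] [DecidableEq ι] {n : ℕ∞ω} {A : F → Matrix ι ι ℝ} {y : F}
    (h : ∀ i j, ContDiffAt ℝ n (fun z => A z i j) y) (i j : ι) :
    ContDiffAt ℝ n (fun z => (A z).adjugate i j) y := by
  simp only [Matrix.adjugate_apply]
  refine contDiffAt_det fun k l => ?_
  by_cases hk : k = j
  · subst hk; simpa using contDiffAt_const
  · simpa [Matrix.updateRow_ne hk] using h k l

/-- Near each point, the chart representation of a smooth frame of the distribution is smooth,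
and the cometric is given by the inverse of the Gram matrix. -/
theorem exists_chartFrame (G : SubLorentzStructure E M) (x₀ : M) :
    ∃ (X : Fin G.rank → ∀ x : M, G.S x),
      (∀ i, ContDiffAt ℝ ∞ (fun y => toChart x₀ ((extChartAt 𝓘(ℝ, E) x₀).symm y)
        (X i ((extChartAt 𝓘(ℝ, E) x₀).symm y) : TangentSpace 𝓘(ℝ, E) _))
        (extChartAt 𝓘(ℝ, E) x₀ x₀)) ∧
      (∀ᶠ y in 𝓝 (extChartAt 𝓘(ℝ, E) x₀ x₀),
        LinearIndependent ℝ (fun i => X i ((extChartAt 𝓘(ℝ, E) x₀).symm y)) ∧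
        Submodule.span ℝ (range fun i => X i ((extChartAt 𝓘(ℝ, E) x₀).symm y)) = ⊤) ∧
      (∀ i j, ContDiffAt ℝ ∞ (fun y =>
        G.gram (fun i => X i ((extChartAt 𝓘(ℝ, E) x₀).symm y)) i j)
        (extChartAt 𝓘(ℝ, E) x₀ x₀)) := by
  obtain ⟨W, hW, hxW, X, hX, hb, hQ⟩ := G.exists_frame x₀
  have hsymm : ContMDiffAt 𝓘(ℝ, E) 𝓘(ℝ, E) ∞ (extChartAt 𝓘(ℝ, E) x₀).symm
      (extChartAt 𝓘(ℝ, E) x₀ x₀) := by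
    have := contMDiffOn_extChartAt_symm (I := 𝓘(ℝ, E)) (n := ∞) x₀
    exact this.contMDiffAt (extChartAt_target_mem_nhds x₀)
  have hleft : (extChartAt 𝓘(ℝ, E) x₀).symm (extChartAt 𝓘(ℝ, E) x₀ x₀) = x₀ :=
    extChartAt_to_inv x₀
  have hev : ∀ᶠ y in 𝓝 (extChartAt 𝓘(ℝ, E) x₀ x₀), (extChartAt 𝓘(ℝ, E) x₀).symm y ∈ W :=
    hsymm.continuousAt.eventually_mem (by rw [hleft]; exact hW.mem_nhds hxW)
  refine ⟨X, fun i => ?_, hev.mono fun y hy => hb _ hy, fun i j => ?_⟩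
  · rw [← contMDiffAt_iff_contDiffAt]
    have h1 := (Bundle.contMDiffAt_section (IB := 𝓘(ℝ, E)) (n := ∞)
      (s := fun x => (X i x : TangentSpace 𝓘(ℝ, E) x)) x₀).1 ((hX i).contMDiffAt (hW.mem_nhds hxW))
    have h2 : ContMDiffAt 𝓘(ℝ, E) 𝓘(ℝ, E) ∞ (fun x => toChart x₀ x
        (X i x : TangentSpace 𝓘(ℝ, E) x)) x₀ := by
      refine h1.congr_of_eventuallyEq ?_
      filter_upwards [(chartAt E x₀).open_source.mem_nhds (mem_chart_source E x₀)] with x hx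
      exact congrFun (Bundle.Trivialization.coe_linearMapAt_of_mem (R := ℝ)
        (trivializationAt E (TangentSpace 𝓘(ℝ, E)) x₀) (by simpa using hx)) _
    exact ContMDiffAt.comp_of_eq h2 hsymm hleft
  · rw [← contMDiffAt_iff_contDiffAt]
    have h2 := (hQ i j).contMDiffAt (hW.mem_nhds hxW)
    exact ContMDiffAt.comp_of_eq h2 hsymm hleft

theorem toChart_cometric_eq_frame (G : SubLorentzStructure E M) {x₀ x : M}
    {X : Fin G.rank → G.S x} (hli : LinearIndependent ℝ X)
    (hspan : Submodule.span ℝ (range X) = ⊤) (ξ : CotangentSpace E x) :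
    toChart x₀ x (G.cometric x ξ : TangentSpace 𝓘(ℝ, E) x) =
      ∑ i, (((G.gram X).det)⁻¹ * ∑ j, (G.gram X).adjugate i j *
        ξ (X j : TangentSpace 𝓘(ℝ, E) x)) •
        toChart x₀ x (X i : TangentSpace 𝓘(ℝ, E) x) := by
  rw [G.cometric_eq_frame hli hspan]
  simp

theorem contDiffAt_chartCometric (G : SubLorentzStructure E M) (x₀ : M) (η₀ : E →L[ℝ] ℝ) :
    ContDiffAt ℝ ∞ (fun z : E × (E →L[ℝ] ℝ) => G.chartCometric x₀ z.1 z.2)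
      (extChartAt 𝓘(ℝ, E) x₀ x₀, η₀) := by
  obtain ⟨X, hX, hb, hQ⟩ := G.exists_chartFrame x₀
  set y₀ := extChartAt 𝓘(ℝ, E) x₀ x₀
  have hfst : ContDiffAt ℝ ∞ (Prod.fst : E × (E →L[ℝ] ℝ) → E) (y₀, η₀) := contDiffAt_fst
  have hdet := (contDiffAt_det hQ).inv (G.det_gram_ne_zero hb.self_of_nhds.1 hb.self_of_nhds.2)
  have hsmooth : ContDiffAt ℝ ∞ (fun z : E × (E →L[ℝ] ℝ) =>
      ∑ i, (((G.gram fun i => X i ((extChartAt 𝓘(ℝ, E) x₀).symm z.1)).det)⁻¹ *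
        ∑ j, (G.gram fun i => X i ((extChartAt 𝓘(ℝ, E) x₀).symm z.1)).adjugate i j *
        z.2 (toChart x₀ ((extChartAt 𝓘(ℝ, E) x₀).symm z.1)
          (X j ((extChartAt 𝓘(ℝ, E) x₀).symm z.1) : TangentSpace 𝓘(ℝ, E) _))) •
        toChart x₀ ((extChartAt 𝓘(ℝ, E) x₀).symm z.1)
          (X i ((extChartAt 𝓘(ℝ, E) x₀).symm z.1) : TangentSpace 𝓘(ℝ, E) _)) (y₀, η₀) := by
    refine ContDiffAt.sum fun i _ => ContDiffAt.smul (ContDiffAt.mul ?_ ?_) ?_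
    · exact ContDiffAt.comp (y₀, η₀) (f := Prod.fst) hdet hfst
    · refine ContDiffAt.sum fun j _ => ContDiffAt.mul ?_ ?_
      · exact ContDiffAt.comp (y₀, η₀) (f := Prod.fst) (contDiffAt_adjugate hQ i j) hfst
      · exact contDiffAt_snd.clm_apply (ContDiffAt.comp (y₀, η₀) (f := Prod.fst) (hX j) hfst)
    · exact ContDiffAt.comp (y₀, η₀) (f := Prod.fst) (hX i) hfst
  refine hsmooth.congr_of_eventuallyEq ?_
  filter_upwards [hfst.continuousAt.eventually hb] with z hz
  exact G.toChart_cometric_eq_frame hz.1 hz.2 _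

/-- Locally, the form `Q` is bounded by the norm in the chart. -/
theorem exists_bound (G : SubLorentzStructure E M) (x₀ : M) :
    ∃ C : ℝ, ∀ᶠ y in 𝓝 (extChartAt 𝓘(ℝ, E) x₀ x₀), ∀ ζ : E →L[ℝ] ℝ,
      |ζ (G.chartCometric x₀ y ζ)| ≤ C * ‖G.chartCometric x₀ y ζ‖ ^ 2 := by
  obtain ⟨X, hX, hb, hQ⟩ := G.exists_chartFrame x₀
  set y₀ := extChartAt 𝓘(ℝ, E) x₀ x₀
  set Y : Fin G.rank → E → E := fun i y => toChart x₀ ((extChartAt 𝓘(ℝ, E) x₀).symm y)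
    (X i ((extChartAt 𝓘(ℝ, E) x₀).symm y) : TangentSpace 𝓘(ℝ, E) _) with hY
  have hYli : LinearIndependent ℝ fun i => Y i y₀ := by
    have h1 := hb.self_of_nhds.1
    have h2 := h1.map' ((toChart x₀ ((extChartAt 𝓘(ℝ, E) x₀).symm y₀)).toLinearMap ∘ₗ (G.S _).subtype) ?_
    · exact h2
    · rw [LinearMap.ker_eq_bot]
      have hinj : Function.Injective (toChart x₀ ((extChartAt 𝓘(ℝ, E) x₀).symm y₀)) :=
        Function.LeftInverse.injective (g := ofChart x₀ ((extChartAt 𝓘(ℝ, E) x₀).symm y₀))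
          fun v => ofChart_toChart (by rw [extChartAt_to_inv]; exact mem_chart_source E x₀) v
      exact fun u v h => Subtype.ext (hinj h)
  obtain ⟨K, hK, hanti⟩ := LinearMap.exists_antilipschitzWith
    (Fintype.linearCombination ℝ fun i => Y i y₀) (LinearMap.ker_eq_bot.2
      (linearIndependent_iff_injective_fintypeLinearCombination.1 hYli))
  have hδ : Tendsto (fun y => ∑ i, ‖Y i y - Y i y₀‖) (𝓝 y₀) (𝓝 0) := by
    have : ContinuousAt (fun y => ∑ i, ‖Y i y - Y i y₀‖) y₀ :=
      tendsto_finsetSum _ fun i _ => ((hX i).continuousAt.sub continuousAt_const).norm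
    simpa [ContinuousAt] using this
  have hq : Tendsto (fun y => ∑ i, ∑ j,
      |G.gram (fun i => X i ((extChartAt 𝓘(ℝ, E) x₀).symm y)) i j|) (𝓝 y₀) (𝓝 (∑ i, ∑ j,
      |G.gram (fun i => X i ((extChartAt 𝓘(ℝ, E) x₀).symm y₀)) i j|)) :=
    tendsto_finsetSum _ fun i _ => tendsto_finsetSum _ fun j _ => (hQ i j).continuousAt.abs
  have hK' : (0 : ℝ) < K := hK
  -- K bounds the coefficients in the frame at y₀ by the norm of the vector. Where the frame has
  -- moved by less than 1/(2K), the error absorbs half of ‖a‖, so 2K is a bound; the Gram entries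
  -- near y₀ exceed their absolute sum at y₀ by less than 1.
  refine ⟨((∑ i, ∑ j, |G.gram (fun i => X i ((extChartAt 𝓘(ℝ, E) x₀).symm y₀)) i j|) + 1) *
    (2 * K) ^ 2, ?_⟩
  filter_upwards [hb, hδ.eventually (gt_mem_nhds (show (0 : ℝ) < 1 / (2 * K) by positivity)),
    hq.eventually (gt_mem_nhds (lt_add_one _))] with y hy hyδ hyq
  intro ζ
  set x := (extChartAt 𝓘(ℝ, E) x₀).symm y
  obtain ⟨a, ha⟩ : ∃ a : Fin G.rank → ℝ, G.cometric x (ζ ∘L toChart x₀ x) = ∑ i, a i • X i x :=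
    ⟨_, G.cometric_eq_frame hy.1 hy.2 _⟩
  have hu : G.chartCometric x₀ y ζ = ∑ i, a i • Y i y := by
    change toChart x₀ x (G.cometric x (ζ ∘L toChart x₀ x) : TangentSpace 𝓘(ℝ, E) x) = _
    rw [ha]
    simp only [Submodule.coe_sum, Submodule.coe_smul, map_sum, map_smul]
    rfl
  have hQa : ζ (G.chartCometric x₀ y ζ) = ∑ i, ∑ j, a i * a j * G.gram (fun i => X i x) i j := by
    have := G.Q_cometric_cometric x (ζ ∘L toChart x₀ x)
    rw [ha] at this
    rw [hu]
    simp only [map_sum, map_smul, LinearMap.sum_apply, LinearMap.smul_apply, smul_eq_mul,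
      Submodule.coe_sum, Submodule.coe_smul, ContinuousLinearMap.comp_apply] at this ⊢
    rw [← this, Finset.sum_comm]
    refine Finset.sum_congr rfl fun i _ => ?_
    rw [Finset.mul_sum]
    refine Finset.sum_congr rfl fun j _ => ?_
    simp only [gram, Matrix.of_apply]
    ring
  have hna : ‖a‖ ≤ 2 * K * ‖∑ i, a i • Y i y‖ := by
    have h1 : ‖a‖ ≤ K * ‖∑ i, a i • Y i y₀‖ := by
      have := hanti.le_mul_norm (map_zero _) a
      simpa [Fintype.linearCombination_apply] using this
    have h2 : ‖∑ i, a i • Y i y₀‖ ≤ ‖∑ i, a i • Y i y‖ + ‖a‖ * ∑ i, ‖Y i y - Y i y₀‖ := by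
      have e : ∑ i, a i • Y i y₀ = ∑ i, a i • Y i y - ∑ i, a i • (Y i y - Y i y₀) := by
        simp [smul_sub]
      rw [e]
      refine (norm_sub_le _ _).trans ?_
      gcongr
      rw [Finset.mul_sum]
      refine (norm_sum_le _ _).trans (Finset.sum_le_sum fun i _ => ?_)
      rw [norm_smul]
      gcongr
      exact norm_le_pi_norm a i
    have h3 : ‖a‖ * ∑ i, ‖Y i y - Y i y₀‖ ≤ ‖a‖ * (1 / (2 * K)) := by gcongr
    have h4 : K * (‖a‖ * (1 / (2 * K))) = ‖a‖ / 2 := by field_simp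
    nlinarith [mul_le_mul_of_nonneg_left (h2.trans (add_le_add_right h3 _)) hK'.le]
  rw [hQa, hu]
  calc |∑ i, ∑ j, a i * a j * G.gram (fun i => X i x) i j|
      ≤ ∑ i, ∑ j, ‖a‖ ^ 2 * |G.gram (fun i => X i x) i j| := by
        refine (Finset.abs_sum_le_sum_abs _ _).trans (Finset.sum_le_sum fun i _ =>
          (Finset.abs_sum_le_sum_abs _ _).trans (Finset.sum_le_sum fun j _ => ?_))
        rw [abs_mul, abs_mul, sq]
        gcongr
        · exact norm_le_pi_norm a i
        · exact norm_le_pi_norm a j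
    _ = (∑ i, ∑ j, |G.gram (fun i => X i x) i j|) * ‖a‖ ^ 2 := by
        simp only [← Finset.mul_sum]; ring
    _ ≤ _ := by
        rw [mul_assoc, ← mul_pow]
        gcongr

end SubLorentzStructure

namespace SubLorentzStructure

variable {E : Type u} [NormedAddCommGroup E] [NormedSpace ℝ E] [FiniteDimensional ℝ E]
  {M : Type v} [TopologicalSpace M] [ChartedSpace E M] [IsManifold 𝓘(ℝ, E) ∞ M]

/-! ### Biextremals -/

theorem contDiffAt_chartHamiltonian (G : SubLorentzStructure E M) (x₀ : M) (η₀ : E →L[ℝ] ℝ) :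
    ContDiffAt ℝ ∞ (fun z : E × (E →L[ℝ] ℝ) => G.chartHamiltonian x₀ z.1 z.2)
      (extChartAt 𝓘(ℝ, E) x₀ x₀, η₀) :=
  contDiffAt_const.mul (contDiffAt_snd.clm_apply (G.contDiffAt_chartCometric x₀ η₀))

theorem hasFDerivAt_chartHamiltonian_left (G : SubLorentzStructure E M) (x₀ : M)
    (η : E →L[ℝ] ℝ) :
    HasFDerivAt (fun y => G.chartHamiltonian x₀ y η)
      (fderiv ℝ (fun y => G.chartHamiltonian x₀ y η) (extChartAt 𝓘(ℝ, E) x₀ x₀))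
      (extChartAt 𝓘(ℝ, E) x₀ x₀) := by
  refine DifferentiableAt.hasFDerivAt ?_
  have h := (G.contDiffAt_chartHamiltonian x₀ η).differentiableAt (by simp)
  exact DifferentiableAt.comp (f := fun y => (y, η)) (extChartAt 𝓘(ℝ, E) x₀ x₀) h
    (differentiableAt_id.prodMk (differentiableAt_const _))

/-- The derivative splits into its two partials. Since the Hamiltonian is quadratic in the covector
and the cometric is symmetric, the partial in the covector is the velocity g η. -/
theorem fderiv_chartHamiltonian_apply (G : SubLorentzStructure E M) (x₀ : M)
    (η : E →L[ℝ] ℝ) (v : E) (ν : E →L[ℝ] ℝ) :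
    fderiv ℝ (fun z : E × (E →L[ℝ] ℝ) => G.chartHamiltonian x₀ z.1 z.2)
      (extChartAt 𝓘(ℝ, E) x₀ x₀, η) (v, ν) =
    fderiv ℝ (fun y => G.chartHamiltonian x₀ y η) (extChartAt 𝓘(ℝ, E) x₀ x₀) v +
      ν (G.chartCometric x₀ (extChartAt 𝓘(ℝ, E) x₀ x₀) η) := by
  set y₀ := extChartAt 𝓘(ℝ, E) x₀ x₀
  have h := ((G.contDiffAt_chartHamiltonian x₀ η).differentiableAt (by simp)).hasFDerivAt
  have h1 := HasFDerivAt.comp (f := fun y => (y, η)) y₀ h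
    ((hasFDerivAt_id y₀).prodMk (hasFDerivAt_const η y₀))
  have e1 := (G.hasFDerivAt_chartHamiltonian_left x₀ η).unique h1
  have h2 : HasDerivAt (fun t : ℝ => G.chartHamiltonian x₀ y₀ (η + t • ν))
      (fderiv ℝ (fun z : E × (E →L[ℝ] ℝ) => G.chartHamiltonian x₀ z.1 z.2) (y₀, η) (0, ν)) 0 := by
    have hc : HasDerivAt (fun t : ℝ => (y₀, η + t • ν)) (0, ν) 0 := by
      have h5 : HasDerivAt (fun t : ℝ => η + t • ν) ν 0 := by
        simpa using ((hasDerivAt_id (0 : ℝ)).smul_const ν).const_add η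
      exact (hasDerivAt_const (0 : ℝ) y₀).prodMk h5
    have h' : HasFDerivAt (fun z : E × (E →L[ℝ] ℝ) => G.chartHamiltonian x₀ z.1 z.2)
        (fderiv ℝ (fun z : E × (E →L[ℝ] ℝ) => G.chartHamiltonian x₀ z.1 z.2) (y₀, η))
        (y₀, η + (0 : ℝ) • ν) := by rw [zero_smul, add_zero]; exact h
    exact HasFDerivAt.comp_hasDerivAt (0 : ℝ) h' hc
  have h3 : HasDerivAt (fun t : ℝ => G.chartHamiltonian x₀ y₀ (η + t • ν))
      (ν (G.chartCometric x₀ y₀ η)) 0 := by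
    have e : (fun t : ℝ => G.chartHamiltonian x₀ y₀ (η + t • ν)) = fun t =>
        (1 / 2) * (η (G.chartCometric x₀ y₀ η) + t * (2 * ν (G.chartCometric x₀ y₀ η)) +
          t ^ 2 * ν (G.chartCometric x₀ y₀ ν)) := by
      funext t
      rw [chartHamiltonian_eq, chartCometric_add, chartCometric_smul]
      have := G.apply_chartCometric_comm x₀ y₀ η ν
      simp [this]
      ring
    rw [e]
    have h4 := ((((hasDerivAt_id (0 : ℝ)).mul_const (2 * ν (G.chartCometric x₀ y₀ η))).const_add
      (η (G.chartCometric x₀ y₀ η))).add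
      ((hasDerivAt_pow 2 (0 : ℝ)).mul_const (ν (G.chartCometric x₀ y₀ ν)))).const_mul (1 / 2)
    refine h4.congr_deriv ?_
    simp
  have e2 := h2.unique h3
  have e3 : ((v, ν) : E × (E →L[ℝ] ℝ)) = (v, 0) + (0, ν) := by simp
  rw [e3, map_add, e2, e1]
  rfl

/-- The Hamiltonian vector field in the chart at `x₀`. -/
def chartField (G : SubLorentzStructure E M) (x₀ : M) (z : E × (E →L[ℝ] ℝ)) :
    E × (E →L[ℝ] ℝ) :=
  (G.chartCometric x₀ z.1 z.2, -fderiv ℝ (fun y => G.chartHamiltonian x₀ y z.2) z.1)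

theorem contDiffAt_chartField (G : SubLorentzStructure E M) (x₀ : M) (η₀ : E →L[ℝ] ℝ) :
    ContDiffAt ℝ 1 (G.chartField x₀) (extChartAt 𝓘(ℝ, E) x₀ x₀, η₀) := by
  refine ((G.contDiffAt_chartCometric x₀ η₀).of_le (by simp)).prodMk (ContDiffAt.neg ?_)
  refine ContDiffAt.fderiv (n := 2)
    (f := fun (z : E × (E →L[ℝ] ℝ)) (y : E) => G.chartHamiltonian x₀ y z.2)
    (g := Prod.fst) ?_ contDiffAt_fst (by norm_num)
  have h := (G.contDiffAt_chartHamiltonian x₀ η₀).of_le (m := 2) ENat.LEInfty.out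
  exact ContDiffAt.comp (f := fun p : (E × (E →L[ℝ] ℝ)) × E => (p.2, p.1.2))
    ((extChartAt 𝓘(ℝ, E) x₀ x₀, η₀), extChartAt 𝓘(ℝ, E) x₀ x₀) h
    (contDiffAt_snd.prodMk (contDiffAt_snd.comp _ contDiffAt_fst))

/-- The components of a point of the cotangent bundle in the chart at `x₀`. -/
def chartLift (x₀ : M) (γ : Σ x : M, CotangentSpace E x) : E × (E →L[ℝ] ℝ) :=
  (extChartAt 𝓘(ℝ, E) x₀ γ.1, γ.2 ∘L ofChart x₀ γ.1)

theorem chartLift_injOn (x₀ : M) {γ δ : Σ x : M, CotangentSpace E x}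
    (hγ : γ.1 ∈ (chartAt E x₀).source) (hδ : δ.1 ∈ (chartAt E x₀).source)
    (h : chartLift x₀ γ = chartLift x₀ δ) : γ = δ := by
  obtain ⟨x, ξ⟩ := γ
  obtain ⟨y, ζ⟩ := δ
  have hxy : x = y := (extChartAt 𝓘(ℝ, E) x₀).injOn (by simpa using hγ) (by simpa using hδ)
    (congrArg Prod.fst h)
  subst hxy
  have h2 : ξ ∘L ofChart x₀ x = ζ ∘L ofChart x₀ x := congrArg Prod.snd h
  have : ξ = ζ := by
    ext v
    have := congrArg (fun A => A (toChart x₀ x v)) h2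
    simp only [ContinuousLinearMap.comp_apply, ofChart_toChart hγ] at this
    exact this
  rw [this]

theorem hamiltonian_eq_chartHamiltonian (G : SubLorentzStructure E M) {x₀ : M}
    {γ : Σ x : M, CotangentSpace E x} (hγ : γ.1 ∈ (chartAt E x₀).source) :
    G.hamiltonian γ.1 γ.2 = G.chartHamiltonian x₀ (chartLift x₀ γ).1 (chartLift x₀ γ).2 := by
  rw [chartHamiltonian_eq, chartLift, G.chartCometric_extChartAt hγ]
  simp only [ContinuousLinearMap.comp_apply, ofChart_toChart hγ]
  rfl

namespace IsBiextremalOn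

variable {G : SubLorentzStructure E M} {Γ Γ₁ Γ₂ : ℝ → Σ x : M, CotangentSpace E x} {a b : ℝ}

theorem hasDerivWithinAt_chartLift (h : G.IsBiextremalOn Γ a b) {s : ℝ} (hs : s ∈ Icc a b)
    {x₀ : M} (hx : (Γ s).1 ∈ (chartAt E x₀).source) :
    HasDerivWithinAt (fun τ => chartLift x₀ (Γ τ)) (G.chartField x₀ (chartLift x₀ (Γ s)))
      (Icc a b) s := by
  obtain ⟨h1, h2⟩ := h.2 s hs x₀ hx
  rw [← G.chartCometric_extChartAt hx] at h1
  exact h1.prodMk h2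

theorem eventually_mem_source (h : G.IsBiextremalOn Γ a b) {s : ℝ} (hs : s ∈ Icc a b) :
    ∀ᶠ τ in 𝓝[Icc a b] s, (Γ τ).1 ∈ (chartAt E (Γ s).1).source :=
  (h.1 s hs).eventually_mem ((chartAt E (Γ s).1).open_source.mem_nhds (mem_chart_source E _))

theorem congr (h : G.IsBiextremalOn Γ₁ a b) (he : EqOn Γ₂ Γ₁ (Icc a b)) :
    G.IsBiextremalOn Γ₂ a b := by
  refine ⟨h.1.congr fun s hs => congrArg Sigma.fst (he hs), fun s hs x₀ hx => ?_⟩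
  rw [he hs] at hx ⊢
  obtain ⟨h1, h2⟩ := h.2 s hs x₀ hx
  exact ⟨h1.congr_of_mem (fun τ hτ => by rw [he hτ]) hs,
    h2.congr_of_mem (fun τ hτ => by rw [he hτ]) hs⟩

/-- A biextremal is determined by its initial point. -/
theorem eqOn [T2Space M] (h₁ : G.IsBiextremalOn Γ₁ a b) (h₂ : G.IsBiextremalOn Γ₂ a b)
    (h0 : Γ₁ a = Γ₂ a) : EqOn Γ₁ Γ₂ (Icc a b) := by
  refine Icc_induction (P := fun s => Γ₁ s = Γ₂ s) h0 (fun s hs he => ?_) fun s hs he => ?_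
  · have hsI : s ∈ Icc a b := Ico_subset_Icc_self hs
    set x₀ := (Γ₁ s).1 with hx₀
    have hs₁ : (Γ₁ s).1 ∈ (chartAt E x₀).source := mem_chart_source E _
    have hs₂ : (Γ₂ s).1 ∈ (chartAt E x₀).source := he ▸ hs₁
    have hev₁ := h₁.eventually_mem_source hsI
    have hev₂ := h₂.eventually_mem_source hsI
    rw [← he] at hev₂
    -- The Hamiltonian field is C¹ at the common point, hence Lipschitz near it, and uniqueness for
    -- ordinary differential equations applies on a short interval to the right.
    obtain ⟨K, N, hN, hK⟩ :=
      (G.contDiffAt_chartField x₀ (chartLift x₀ (Γ₁ s)).2).exists_lipschitzOnWith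
    have hN₁ := (h₁.hasDerivWithinAt_chartLift hsI hs₁).continuousWithinAt.eventually_mem hN
    have hN₂ := (h₂.hasDerivWithinAt_chartLift hsI hs₂).continuousWithinAt.eventually_mem
      (show N ∈ 𝓝 (chartLift x₀ (Γ₂ s)) by rw [← he]; exact hN)
    have hle : 𝓝[≥] s ≤ 𝓝[Icc a b] s :=
      nhdsWithin_le_of_mem (mem_of_superset (Icc_mem_nhdsGE hs.2) (Icc_subset_Icc_left hs.1))
    have hall : ∀ᶠ τ in 𝓝[≥] s, τ ∈ Icc a b ∧ (Γ₁ τ).1 ∈ (chartAt E x₀).source ∧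
        (Γ₂ τ).1 ∈ (chartAt E x₀).source ∧ chartLift x₀ (Γ₁ τ) ∈ N ∧
        chartLift x₀ (Γ₂ τ) ∈ N := by
      filter_upwards [hle self_mem_nhdsWithin, hle hev₁, hle hev₂, hle hN₁, hle hN₂]
        with τ h1 h2 h3 h4 h5 using ⟨h1, h2, h3, h4, h5⟩
    obtain ⟨d, hd, hsub⟩ := (mem_nhdsGE_iff_exists_Icc_subset).1 hall
    have hEq : EqOn (fun τ => chartLift x₀ (Γ₁ τ)) (fun τ => chartLift x₀ (Γ₂ τ)) (Icc s d) := by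
      have hmem : ∀ τ ∈ Ico s d, Icc a b ∈ 𝓝[≥] τ := fun τ hτ => by
        have hd' := (hsub (right_mem_Icc.2 (le_of_lt hd))).1.2
        exact mem_of_superset (Icc_mem_nhdsGE (hτ.2.trans_le hd'))
          (Icc_subset_Icc_left (hs.1.trans hτ.1))
      refine ODE_solution_unique_of_mem_Icc_right (v := fun _ => G.chartField x₀)
        (s := fun _ => N) (K := K) (fun _ _ => hK) ?_ ?_ ?_ ?_ ?_ ?_ (by simp only [he])
      · exact fun τ hτ => (h₁.hasDerivWithinAt_chartLift (hsub hτ).1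
          (hsub hτ).2.1).continuousWithinAt.mono fun σ hσ => (hsub hσ).1
      · exact fun τ hτ => (h₁.hasDerivWithinAt_chartLift (hsub (Ico_subset_Icc_self hτ)).1
          (hsub (Ico_subset_Icc_self hτ)).2.1).mono_of_mem_nhdsWithin (hmem τ hτ)
      · exact fun τ hτ => (hsub (Ico_subset_Icc_self hτ)).2.2.2.1
      · exact fun τ hτ => (h₂.hasDerivWithinAt_chartLift (hsub hτ).1
          (hsub hτ).2.2.1).continuousWithinAt.mono fun σ hσ => (hsub hσ).1
      · exact fun τ hτ => (h₂.hasDerivWithinAt_chartLift (hsub (Ico_subset_Icc_self hτ)).1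
          (hsub (Ico_subset_Icc_self hτ)).2.2.1).mono_of_mem_nhdsWithin (hmem τ hτ)
      · exact fun τ hτ => (hsub (Ico_subset_Icc_self hτ)).2.2.2.2
    filter_upwards [Ioc_mem_nhdsGT hd] with τ hτ
    have hτ' := Ioc_subset_Icc_self hτ
    exact chartLift_injOn x₀ (hsub hτ').2.1 (hsub hτ').2.2.1 (hEq hτ')
  · have hsI : s ∈ Icc a b := Ioc_subset_Icc_self hs
    have hne : (𝓝[Ico a s] s).NeBot := by
      rw [← mem_closure_iff_nhdsWithin_neBot, closure_Ico hs.1.ne]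
      exact right_mem_Icc.2 hs.1.le
    have hle : 𝓝[Ico a s] s ≤ 𝓝[Icc a b] s :=
      nhdsWithin_mono _ fun τ hτ => ⟨hτ.1, hτ.2.le.trans hs.2⟩
    have hev : ∀ᶠ τ in 𝓝[Ico a s] s, Γ₁ τ = Γ₂ τ := by
      filter_upwards [self_mem_nhdsWithin] with τ hτ using he τ hτ
    -- Positions first, by uniqueness of limits in the Hausdorff space M; after that one chart
    -- serves for comparing the covectors.
    have hx : (Γ₁ s).1 = (Γ₂ s).1 := by
      refine tendsto_nhds_unique ((h₁.1 s hsI).mono_left hle)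
        (((h₂.1 s hsI).mono_left hle).congr' ?_)
      filter_upwards [hev] with τ hτ using by rw [hτ]
    have hs₁ : (Γ₁ s).1 ∈ (chartAt E (Γ₁ s).1).source := mem_chart_source E _
    have hs₂ : (Γ₂ s).1 ∈ (chartAt E (Γ₁ s).1).source := hx ▸ hs₁
    refine chartLift_injOn (Γ₁ s).1 hs₁ hs₂ ?_
    refine tendsto_nhds_unique
      ((h₁.hasDerivWithinAt_chartLift hsI hs₁).continuousWithinAt.mono_left hle)
      (((h₂.hasDerivWithinAt_chartLift hsI hs₂).continuousWithinAt.mono_left hle).congr' ?_)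
    filter_upwards [hev] with τ hτ using by rw [hτ]

/-- The Hamiltonian is constant along biextremals. -/
theorem hamiltonian_eq (h : G.IsBiextremalOn Γ a b) {s : ℝ} (hs : s ∈ Icc a b) :
    G.hamiltonian (Γ s).1 (Γ s).2 = G.hamiltonian (Γ a).1 (Γ a).2 := by
  have hder : ∀ s ∈ Icc a b,
      HasDerivWithinAt (fun τ => G.hamiltonian (Γ τ).1 (Γ τ).2) 0 (Icc a b) s := by
    intro s hs
    set x₀ := (Γ s).1 with hx₀
    have hx : (Γ s).1 ∈ (chartAt E x₀).source := mem_chart_source E _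
    have h1 := ((G.contDiffAt_chartHamiltonian x₀
      (chartLift x₀ (Γ s)).2).differentiableAt (by simp)).hasFDerivAt
    have h2 := HasFDerivAt.comp_hasDerivWithinAt (f := fun τ => chartLift x₀ (Γ τ)) s h1
      (h.hasDerivWithinAt_chartLift hs hx)
    refine (h2.congr_of_eventuallyEq ?_ (G.hamiltonian_eq_chartHamiltonian hx)).congr_deriv ?_
    · filter_upwards [h.eventually_mem_source hs] with τ hτ
        using G.hamiltonian_eq_chartHamiltonian hτ
    -- By Hamilton's equations the two partial derivatives cancel.
    · rw [chartField, fderiv_chartHamiltonian_apply]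
      simp [chartLift, x₀]
  refine constant_of_has_deriv_right_zero (fun τ hτ => (hder τ hτ).continuousWithinAt)
    (fun τ hτ => ?_) s hs
  exact (hder τ (Ico_subset_Icc_self hτ)).mono_of_mem_nhdsWithin
    (mem_of_superset (Icc_mem_nhdsGE hτ.2) (Icc_subset_Icc_left hτ.1))

/-- Slowing the time by r multiplies ẋ by r and, after scaling the covector, ξ̇ by r²; this matches
the degrees of g ξ and ∂H/∂x in ξ. It identifies exp(r w) with x_w(r). -/
theorem rescale (h : G.IsBiextremalOn Γ 0 1) {r : ℝ} (hr : r ∈ Icc (0 : ℝ) 1) :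
    G.IsBiextremalOn (fun s => ⟨(Γ (r * s)).1, r • (Γ (r * s)).2⟩) 0 1 := by
  have hmaps : MapsTo (fun s => r * s) (Icc (0 : ℝ) 1) (Icc 0 1) := fun s hs =>
    ⟨mul_nonneg hr.1 hs.1, mul_le_one₀ hr.2 hs.1 hs.2⟩
  refine ⟨h.1.comp (by fun_prop) hmaps, fun s hs x₀ hx => ?_⟩
  obtain ⟨h1, h2⟩ := h.2 (r * s) (hmaps hs) x₀ hx
  have hm : HasDerivWithinAt (fun s => r * s) r (Icc 0 1) s := by
    simpa using ((hasDerivAt_id s).const_mul r).hasDerivWithinAt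
  refine ⟨?_, ?_⟩
  · refine (h1.scomp s hm hmaps).congr_deriv ?_
    rw [cometric_smul, Submodule.coe_smul, map_smul]
  · refine ((h2.scomp s hm hmaps).const_smul r).congr_deriv ?_
    have e : (fun y => G.chartHamiltonian x₀ y ((r • (Γ (r * s)).2) ∘L
        (trivializationAt E (TangentSpace 𝓘(ℝ, E)) x₀).symmL ℝ (Γ (r * s)).1)) =
        (r * r) • fun y => G.chartHamiltonian x₀ y ((Γ (r * s)).2 ∘L
        (trivializationAt E (TangentSpace 𝓘(ℝ, E)) x₀).symmL ℝ (Γ (r * s)).1) := by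
      funext y
      simp only [Pi.smul_apply, chartHamiltonian_eq, ContinuousLinearMap.smul_comp,
        chartCometric_smul]
      simp
      ring
    simp only
    rw [e, fderiv_const_smul_field, Pi.smul_apply, smul_neg, smul_neg, smul_smul]

end IsBiextremalOn

/-! ### The exponential map along rays -/

theorem exp_eq [T2Space M] {G : SubLorentzStructure E M} {p : M} {w : E →L[ℝ] ℝ}
    {Γ : ℝ → Σ x : M, CotangentSpace E x} (h : G.IsBiextremalOn Γ 0 1) (h0 : Γ 0 = ⟨p, w⟩) :
    G.exp p w = (Γ 1).1 := by
  have hw : w ∈ G.expDomain p := ⟨Γ, h, h0⟩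
  obtain ⟨h1, h2⟩ := Classical.choose_spec hw
  rw [exp, dif_pos hw]
  rw [h1.eqOn h (h2.trans h0.symm) (right_mem_Icc.2 zero_le_one)]

theorem sigma_mk_eq {x : M} (γ : Σ x : M, CotangentSpace E x) (h : x = γ.1) :
    (⟨x, (γ.2 : E →L[ℝ] ℝ)⟩ : Σ x : M, CotangentSpace E x) = γ := by
  subst h; rfl

/-- The base curve is written literally as s ↦ exp(s w), so that its velocity can be computed
through the differential of exp. -/
theorem exists_momentum [T2Space M] {G : SubLorentzStructure E M} {p : M} {w : E →L[ℝ] ℝ}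
    (hw : w ∈ G.expDomain p) : ∃ ξ : ℝ → (E →L[ℝ] ℝ),
      G.IsBiextremalOn (fun s => ⟨G.exp p (s • w), ξ s⟩) 0 1 ∧ ξ 0 = w ∧ G.exp p 0 = p := by
  obtain ⟨Γ, h, h0⟩ := hw
  have key : ∀ s ∈ Icc (0 : ℝ) 1, G.exp p (s • w) = (Γ s).1 := by
    intro s hs
    have := exp_eq (p := p) (w := s • w) (h.rescale hs) (by
      rw [mul_zero, h0]
      rfl)
    simpa using this
  have key0 := key 0 (left_mem_Icc.2 zero_le_one)
  rw [zero_smul, h0] at key0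
  refine ⟨fun s => (Γ s).2, h.congr fun s hs => sigma_mk_eq _ (key s hs), ?_, key0⟩
  have : ∀ γ : Σ x : M, CotangentSpace E x, γ = ⟨p, w⟩ → (γ.2 : E →L[ℝ] ℝ) = w := by
    rintro _ rfl; rfl
  exact this _ h0

end SubLorentzStructure

/-! ### The variation argument in coordinates -/

theorem hasDerivAt_zero_of_abs_le_norm_sq {F : Type*} [NormedAddCommGroup F] [NormedSpace ℝ F]
    {R : ℝ → ℝ} {u : ℝ → F} {u' : F} {C t : ℝ} (hu : HasDerivAt u u' t) (hu0 : u t = 0)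
    (h : ∀ᶠ ε in 𝓝 t, |R ε| ≤ C * ‖u ε‖ ^ 2) : HasDerivAt R 0 t := by
  have hR0 : R t = 0 := by simpa [hu0] using h.self_of_nhds
  rw [hasDerivAt_iff_isLittleO]
  simp only [hR0, sub_zero, smul_zero]
  have h1 : R =O[𝓝 t] fun ε => ‖u ε‖ ^ 2 := by
    refine Asymptotics.IsBigO.of_bound C ?_
    filter_upwards [h] with ε hε
    simpa using hε
  have h2 : u =O[𝓝 t] fun ε => ε - t := by
    simpa [hu0] using hu.isBigO_sub
  have h3 : (fun ε : ℝ => (ε - t) ^ 2) =o[𝓝 t] fun ε => ε - t := by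
    have : Tendsto (fun ε : ℝ => ε - t) (𝓝 t) (𝓝 0) := by
      simpa using (continuous_sub_right t).tendsto t
    simpa [Function.comp_def] using
      (Asymptotics.isLittleO_pow_id (𝕜 := ℝ) (n := 2) one_lt_two).comp_tendsto this
  exact (h1.trans (h2.norm_left.pow 2)).trans_isLittleO h3

/-- The Gauss lemma in coordinates: `F` is the exponential map, `ζ` the momentum along the radial
extremal, `h` the Hamiltonian with frozen momentum, `κ` the cometric applied to the frozen momentum,
and `N` the energy of the varied extremals. -/
theorem hasDerivWithinAt_momentum_variation {Z F : Type*} [NormedAddCommGroup Z] [NormedSpace ℝ Z]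
    [NormedAddCommGroup F] [NormedSpace ℝ F] {f : Z → F} {w η : Z} {t : ℝ}
    (hf : ContDiffAt ℝ 2 f (t • w)) {h : F → ℝ} {h' : F →L[ℝ] ℝ} (hh : HasFDerivAt h h' (f (t • w)))
    {κ : F → F} (hκ : DifferentiableAt ℝ κ (f (t • w)))
    (hκt : κ (f (t • w)) = fderiv ℝ f (t • w) w)
    {N : ℝ → ℝ} {n : ℝ} (hN : HasDerivAt N (2 * n) 0)
    {ζ : ℝ → (F →L[ℝ] ℝ)} {S : Set ℝ} (hζ : HasDerivWithinAt ζ (-h') S t) {C : ℝ}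
    (hR : ∀ᶠ ε in 𝓝 (0 : ℝ), |2 * h (f (t • (w + ε • η))) -
      2 * ζ t (fderiv ℝ f (t • (w + ε • η)) (w + ε • η)) + N ε| ≤
      C * ‖κ (f (t • (w + ε • η))) - fderiv ℝ f (t • (w + ε • η)) (w + ε • η)‖ ^ 2) :
    HasDerivWithinAt (fun s => ζ s (fderiv ℝ f (s • w) (s • η))) n S t := by
  have hF1 : HasFDerivAt f (fderiv ℝ f (t • w)) (t • w) :=
    (hf.differentiableAt (by simp)).hasFDerivAt
  have hF2 : HasFDerivAt (fderiv ℝ f) (fderiv ℝ (fderiv ℝ f) (t • w)) (t • w) :=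
    ((hf.fderiv_right (m := 1) (by norm_num)).differentiableAt (by simp)).hasFDerivAt
  have hsymm : ∀ u v, fderiv ℝ (fderiv ℝ f) (t • w) u v = fderiv ℝ (fderiv ℝ f) (t • w) v u :=
    hf.isSymmSndFDerivAt (by simp)
  have hline : HasDerivAt (fun s : ℝ => s • w) w t := by
    simpa using (hasDerivAt_id t).smul_const w
  have hlineη : HasDerivAt (fun s : ℝ => s • η) η t := by
    simpa using (hasDerivAt_id t).smul_const η
  have hDline : HasDerivAt (fun s : ℝ => fderiv ℝ f (s • w))
      (fderiv ℝ (fderiv ℝ f) (t • w) w) t := HasFDerivAt.comp_hasDerivAt t hF2 hline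
  have hYd : HasDerivAt (fun s : ℝ => fderiv ℝ f (s • w) (s • η))
      (fderiv ℝ (fderiv ℝ f) (t • w) w (t • η) + fderiv ℝ f (t • w) η) t :=
    hDline.clm_apply hlineη
  have hvar : HasDerivAt (fun ε : ℝ => w + ε • η) η 0 := by
    simpa using ((hasDerivAt_id (0 : ℝ)).smul_const η).const_add w
  have hvars : HasDerivAt (fun ε : ℝ => t • (w + ε • η)) (t • η) 0 := hvar.const_smul t
  have hw0 : t • w = t • (w + (0 : ℝ) • η) := by simp
  have hGd : HasDerivAt (fun ε : ℝ => f (t • (w + ε • η))) (fderiv ℝ f (t • w) (t • η)) 0 :=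
    HasFDerivAt.comp_hasDerivAt_of_eq (0 : ℝ) hF1 hvars hw0
  have hDd : HasDerivAt (fun ε : ℝ => fderiv ℝ f (t • (w + ε • η)) (w + ε • η))
      (fderiv ℝ (fderiv ℝ f) (t • w) (t • η) w + fderiv ℝ f (t • w) η) 0 := by
    have := (HasFDerivAt.comp_hasDerivAt_of_eq (0 : ℝ) hF2 hvars hw0).clm_apply hvar
    simpa using this
  have hud := (HasFDerivAt.comp_hasDerivAt_of_eq (0 : ℝ) hκ.hasFDerivAt hGd (by simp)).sub hDd
  -- The expression in `hR` is bounded by the square of a differentiable quantity vanishing at ε =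
  -- 0, so its derivative there is zero. Computing the same derivative term by term gives the
  -- identity `hkey`.
  have hR0 := hasDerivAt_zero_of_abs_le_norm_sq hud (by simp [hκt]) hR
  have hRd := (((HasFDerivAt.comp_hasDerivAt_of_eq (0 : ℝ) hh hGd (by simp)).const_mul 2).sub
    (((ζ t).hasFDerivAt.comp_hasDerivAt (0 : ℝ) hDd).const_mul 2)).add hN
  have hkey := hR0.unique hRd
  refine (hζ.clm_apply hYd.hasDerivWithinAt).congr_deriv ?_
  -- Symmetry of the second derivative identifies the s-derivative of the variation field with the
  -- ε-derivative of the velocity.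
  rw [hsymm (t • η) w] at hkey
  simp only [neg_apply]
  linarith

namespace SubLorentzStructure

variable {E : Type u} [NormedAddCommGroup E] [NormedSpace ℝ E] [FiniteDimensional ℝ E]
  {M : Type v} [TopologicalSpace M] [ChartedSpace E M] [IsManifold 𝓘(ℝ, E) ∞ M]

/-! ### The Gauss lemma -/

/-- The cometric at `x`, as a continuous linear map into the model space. -/
def sharp (G : SubLorentzStructure E M) (x : M) : (E →L[ℝ] ℝ) →L[ℝ] E :=
  LinearMap.toContinuousLinearMap
    { toFun := fun η => (G.cometric x η : TangentSpace 𝓘(ℝ, E) x)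
      map_add' := fun η ζ => congrArg Subtype.val (G.cometric_add x η ζ)
      map_smul' := fun r η => congrArg Subtype.val (G.cometric_smul x r η) }

theorem apply_sharp_comm (G : SubLorentzStructure E M) (x : M) (η ζ : E →L[ℝ] ℝ) :
    η (G.sharp x ζ) = ζ (G.sharp x η) :=
  G.apply_cometric_comm x η ζ

/-- The differential of the exponential map, as a map between vector spaces. -/
def dexp (G : SubLorentzStructure E M) (p : M) (z : E →L[ℝ] ℝ) : (E →L[ℝ] ℝ) →L[ℝ] E :=
  mfderiv 𝓘(ℝ, E →L[ℝ] ℝ) 𝓘(ℝ, E) (G.exp p) z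

namespace IsNormalNeighborhood

variable {G : SubLorentzStructure E M} {p : M} {V : Set (E →L[ℝ] ℝ)} {U : Set M}

theorem smul_mem (hU : G.IsNormalNeighborhood p V U) {w : E →L[ℝ] ℝ} (hw : w ∈ V) {s : ℝ}
    (hs : s ∈ Icc (0 : ℝ) 1) : s • w ∈ V :=
  hU.starConvex.smul_mem hw hs.1 hs.2

theorem contMDiffAt_exp (hU : G.IsNormalNeighborhood p V U) {z : E →L[ℝ] ℝ} (hz : z ∈ V) :
    ContMDiffAt 𝓘(ℝ, E →L[ℝ] ℝ) 𝓘(ℝ, E) ∞ (G.exp p) z :=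
  hU.smooth.contMDiffAt (hU.isOpen_covectors.mem_nhds hz)

theorem contDiffAt_chart_exp (hU : G.IsNormalNeighborhood p V U) {z : E →L[ℝ] ℝ} (hz : z ∈ V)
    {x₀ : M} (hx : G.exp p z ∈ (chartAt E x₀).source) :
    ContDiffAt ℝ ∞ (fun z => extChartAt 𝓘(ℝ, E) x₀ (G.exp p z)) z := by
  rw [← contMDiffAt_iff_contDiffAt]
  exact ContMDiffAt.comp z (contMDiffAt_extChartAt' hx) (hU.contMDiffAt_exp hz)

theorem hasFDerivAt_chart_exp (hU : G.IsNormalNeighborhood p V U) {z : E →L[ℝ] ℝ} (hz : z ∈ V)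
    {x₀ : M} (hx : G.exp p z ∈ (chartAt E x₀).source) :
    HasFDerivAt (fun z => extChartAt 𝓘(ℝ, E) x₀ (G.exp p z))
      ((toChart x₀ (G.exp p z) : E →L[ℝ] E) ∘L G.dexp p z) z := by
  have h1 : MDifferentiableAt 𝓘(ℝ, E) 𝓘(ℝ, E) (extChartAt 𝓘(ℝ, E) x₀) (G.exp p z) :=
    mdifferentiableAt_extChartAt hx
  have h2 : MDifferentiableAt 𝓘(ℝ, E →L[ℝ] ℝ) 𝓘(ℝ, E) (G.exp p) z :=
    (hU.contMDiffAt_exp hz).mdifferentiableAt (by simp)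
  have h3 := h1.hasMFDerivAt.comp z h2.hasMFDerivAt
  rw [← TangentBundle.continuousLinearMapAt_trivializationAt hx] at h3
  exact hasMFDerivAt_iff_hasFDerivAt.1 h3

/-- The velocity of the radial extremals. -/
theorem dexp_radial [T2Space M] (hU : G.IsNormalNeighborhood p V U) {w : E →L[ℝ] ℝ}
    (hw : w ∈ V) {ξ : ℝ → (E →L[ℝ] ℝ)}
    (hξ : G.IsBiextremalOn (fun s => ⟨G.exp p (s • w), ξ s⟩) 0 1) {s : ℝ}
    (hs : s ∈ Icc (0 : ℝ) 1) :
    G.dexp p (s • w) w = G.sharp (G.exp p (s • w)) (ξ s) := by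
  set x₀ := G.exp p (s • w) with hx₀
  have hx : G.exp p (s • w) ∈ (chartAt E x₀).source := mem_chart_source E _
  have h1 := (hξ.2 s hs x₀ hx).1
  have h2 : HasDerivAt (fun s : ℝ => s • w) w s := by
    simpa using (hasDerivAt_id s).smul_const w
  have h3 := (HasFDerivAt.comp_hasDerivAt s (hU.hasFDerivAt_chart_exp (hU.smul_mem hw hs) hx)
    h2).hasDerivWithinAt (s := Icc 0 1)
  have h4 := (uniqueDiffOn_Icc zero_lt_one s hs).eq_deriv _ h3 h1
  have h5 := congrArg (ofChart x₀ (G.exp p (s • w))) h4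
  exact ((ofChart_toChart hx _).symm.trans h5).trans (ofChart_toChart hx _)

theorem exp_zero [T2Space M] (hU : G.IsNormalNeighborhood p V U) : G.exp p 0 = p := by
  obtain ⟨ξ, h1, h2, h3⟩ := exists_momentum (hU.subset_expDomain hU.zero_mem)
  exact h3

theorem momentum_sharp (hp : G.exp p 0 = p) {w : E →L[ℝ] ℝ} {ξ : ℝ → (E →L[ℝ] ℝ)}
    (hξ : G.IsBiextremalOn (fun s => ⟨G.exp p (s • w), ξ s⟩) 0 1) (hξ0 : ξ 0 = w) {s : ℝ}
    (hs : s ∈ Icc (0 : ℝ) 1) :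
    ξ s (G.sharp (G.exp p (s • w)) (ξ s)) = w (G.sharp p w) := by
  have h : (1 / 2) * ξ s (G.sharp (G.exp p (s • w)) (ξ s)) =
      (1 / 2) * ξ 0 (G.sharp (G.exp p ((0 : ℝ) • w)) (ξ 0)) := hξ.hamiltonian_eq hs
  rw [zero_smul, hp, hξ0] at h
  linarith

/-- The differential of the exponential map at the origin. -/
theorem dexp_zero [T2Space M] (hU : G.IsNormalNeighborhood p V U) (η : E →L[ℝ] ℝ) :
    G.dexp p 0 η = G.sharp p η := by
  -- η may lie outside V; a small multiple r η lies in V, and r is cancelled at the end by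
  -- linearity.
  have h1 : Tendsto (fun r : ℝ => r • η) (𝓝[>] 0) (𝓝 0) := by
    have : ContinuousAt (fun r : ℝ => r • η) 0 := by fun_prop
    simpa [ContinuousAt] using this.mono_left nhdsWithin_le_nhds
  obtain ⟨r, hr, hr0⟩ := ((h1.eventually_mem (hU.isOpen_covectors.mem_nhds hU.zero_mem)).and
    self_mem_nhdsWithin).exists
  obtain ⟨ξ, hξ, hξ0, hp⟩ := exists_momentum (hU.subset_expDomain hr)
  have := hU.dexp_radial hr hξ (left_mem_Icc.2 zero_le_one)
  rw [zero_smul, hp, hξ0, map_smul, map_smul] at this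
  exact smul_right_injective E (ne_of_gt hr0) this

/-- The core of the Gauss lemma. Vary w to w + εη at fixed time, freeze the momentum ζ of the
original extremal, and let ζ' be a momentum of the varied one. The quadratic form of the cometric at
ζ - ζ' is bounded by ‖g(ζ - ζ')‖², and g(ζ - ζ') is differentiable in ε and vanishes at ε = 0. So
the form has zero derivative at ε = 0, without any regularity of ζ' in ε. -/
theorem hasDerivWithinAt_momentum_dexp [T2Space M] (hU : G.IsNormalNeighborhood p V U)
    {w : E →L[ℝ] ℝ} (hw : w ∈ V) {ξ : ℝ → (E →L[ℝ] ℝ)}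
    (hξ : G.IsBiextremalOn (fun s => ⟨G.exp p (s • w), ξ s⟩) 0 1)
    (η : E →L[ℝ] ℝ) {s₀ : ℝ} (hs₀ : s₀ ∈ Icc (0 : ℝ) 1) :
    HasDerivWithinAt (fun s => ξ s (G.dexp p (s • w) (s • η))) (η (G.sharp p w))
      (Icc 0 1) s₀ := by
  have hp := hU.exp_zero
  set x₀ := G.exp p (s₀ • w) with hx₀
  set y₀ := extChartAt 𝓘(ℝ, E) x₀ x₀ with hy₀
  set F : (E →L[ℝ] ℝ) → E := fun z => extChartAt 𝓘(ℝ, E) x₀ (G.exp p z) with hF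
  have hx : G.exp p (s₀ • w) ∈ (chartAt E x₀).source := mem_chart_source E _
  have hz : s₀ • w ∈ V := hU.smul_mem hw hs₀
  have hFs : ContDiffAt ℝ ∞ F (s₀ • w) := hU.contDiffAt_chart_exp hz hx
  have hVs : V ∈ 𝓝 (s₀ • w) := hU.isOpen_covectors.mem_nhds hz
  have hnear : ∀ᶠ z in 𝓝 (s₀ • w), z ∈ V ∧ G.exp p z ∈ (chartAt E x₀).source :=
    Filter.Eventually.and hVs ((hU.contMDiffAt_exp hz).continuousAt.eventually_mem
      ((chartAt E x₀).open_source.mem_nhds hx))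
  have hFd : ∀ z, z ∈ V ∧ G.exp p z ∈ (chartAt E x₀).source → ∀ u,
      fderiv ℝ F z u = (toChart x₀ (G.exp p z) : E →L[ℝ] E) (G.dexp p z u) := fun z hz u => by
    rw [(hU.hasFDerivAt_chart_exp hz.1 hz.2).fderiv]; rfl
  set ζ : ℝ → (E →L[ℝ] ℝ) := fun s => ξ s ∘L (ofChart x₀ (G.exp p (s • w)) : E →L[ℝ] E) with hζ
  have hζd : HasDerivWithinAt ζ (-fderiv ℝ (fun y => G.chartHamiltonian x₀ y (ζ s₀)) y₀)
      (Icc 0 1) s₀ := (hξ.2 s₀ hs₀ x₀ hx).2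
  have hκ : DifferentiableAt ℝ (fun y => G.chartCometric x₀ y (ζ s₀)) y₀ :=
    DifferentiableAt.comp (f := fun y => (y, ζ s₀)) y₀
      ((G.contDiffAt_chartCometric x₀ (ζ s₀)).differentiableAt (by simp))
      (differentiableAt_id.prodMk (differentiableAt_const _))
  -- the radial velocities in the chart
  have hvel : ∀ w' ∈ V, s₀ • w' ∈ V ∧ G.exp p (s₀ • w') ∈ (chartAt E x₀).source →
      ∃ ζ' : E →L[ℝ] ℝ, G.chartCometric x₀ (F (s₀ • w')) ζ' = fderiv ℝ F (s₀ • w') w' ∧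
        ζ' (fderiv ℝ F (s₀ • w') w') = w' (G.sharp p w') := by
    intro w' hw' hsw'
    obtain ⟨ξ', hξ', hξ'0, -⟩ := exists_momentum (hU.subset_expDomain hw')
    have h1 := hFd _ hsw' w'
    rw [hU.dexp_radial hw' hξ' hs₀] at h1
    refine ⟨ξ' s₀ ∘L (ofChart x₀ (G.exp p (s₀ • w')) : E →L[ℝ] E), ?_, ?_⟩
    · rw [h1]
      exact G.chartCometric_extChartAt hsw'.2 (ξ' s₀)
    · rw [h1, ← momentum_sharp hp hξ' hξ'0 hs₀]
      exact congrArg (ξ' s₀) (ofChart_toChart hsw'.2 _)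
  have hκ0 : G.chartCometric x₀ (F (s₀ • w)) (ζ s₀) = fderiv ℝ F (s₀ • w) w := by
    rw [hFd _ ⟨hz, hx⟩ w, hU.dexp_radial hw hξ hs₀]
    exact G.chartCometric_extChartAt hx (ξ s₀)
  have hNd : HasDerivAt (fun ε : ℝ => (w + ε • η) (G.sharp p (w + ε • η)))
      (2 * η (G.sharp p w)) 0 := by
    have hvar : HasDerivAt (fun ε : ℝ => w + ε • η) η 0 := by
      simpa using ((hasDerivAt_id (0 : ℝ)).smul_const η).const_add w
    refine (hvar.clm_apply ((G.sharp p).hasFDerivAt.comp_hasDerivAt (0 : ℝ) hvar)).congr_deriv ?_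
    have := G.apply_sharp_comm p w η
    simp [this]
    ring
  obtain ⟨C, hC⟩ := G.exists_bound x₀
  have hline0 : Tendsto (fun ε : ℝ => w + ε • η) (𝓝 0) (𝓝 w) := by
    have : ContinuousAt (fun ε : ℝ => w + ε • η) 0 := by fun_prop
    simpa [ContinuousAt] using this
  have hline1 : Tendsto (fun ε : ℝ => s₀ • (w + ε • η)) (𝓝 0) (𝓝 (s₀ • w)) :=
    hline0.const_smul s₀
  have hmain := hasDerivWithinAt_momentum_variation (f := F) (w := w) (η := η) (t := s₀)
    (h := fun y => G.chartHamiltonian x₀ y (ζ s₀))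
    (κ := fun y => G.chartCometric x₀ y (ζ s₀)) (C := C)
    (hFs.of_le ENat.LEInfty.out) (G.hasFDerivAt_chartHamiltonian_left x₀ (ζ s₀)) hκ hκ0 hNd hζd ?_
  · have heq : ∀ s, s • w ∈ V ∧ G.exp p (s • w) ∈ (chartAt E x₀).source →
        ξ s (G.dexp p (s • w) (s • η)) = ζ s (fderiv ℝ F (s • w) (s • η)) := by
      intro s hs
      rw [hFd _ hs]
      exact (congrArg (ξ s) (ofChart_toChart hs.2 _)).symm
    refine hmain.congr_of_eventuallyEq ?_ (heq s₀ ⟨hz, hx⟩)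
    have hc : Tendsto (fun s : ℝ => s • w) (𝓝[Icc 0 1] s₀) (𝓝 (s₀ • w)) :=
      (continuousAt_id.smul continuousAt_const).tendsto.mono_left nhdsWithin_le_nhds
    filter_upwards [hc.eventually hnear] with s hs using heq s hs
  · have hFc : Tendsto F (𝓝 (s₀ • w)) (𝓝 y₀) := hFs.continuousAt
    filter_upwards [hline0.eventually_mem (hU.isOpen_covectors.mem_nhds hw),
      hline1.eventually hnear, hline1.eventually (hFc.eventually hC)] with ε h1 h2 h3
    obtain ⟨ζ', h4, h5⟩ := hvel _ h1 h2
    -- The form at ζ - ζ' expands to 2H(ζ) - 2ζ(velocity) + energy, since ζ' enters only through its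
    -- velocity g ζ' and its conserved energy.
    have h6 : G.chartCometric x₀ (F (s₀ • (w + ε • η))) (ζ s₀ - ζ') =
        G.chartCometric x₀ (F (s₀ • (w + ε • η))) (ζ s₀) -
          fderiv ℝ F (s₀ • (w + ε • η)) (w + ε • η) := by
      rw [sub_eq_add_neg, ← neg_one_smul ℝ ζ', chartCometric_add, chartCometric_smul, h4,
        neg_one_smul, sub_eq_add_neg]
    have h7 := h3 (ζ s₀ - ζ')
    rw [h6] at h7
    convert h7 using 2
    have h8 := G.apply_chartCometric_comm x₀ (F (s₀ • (w + ε • η))) ζ' (ζ s₀)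
    rw [h4] at h8
    rw [chartHamiltonian_eq, sub_apply, map_sub, map_sub, h8, h5]
    ring

/-- The Gauss lemma. -/
theorem gauss [T2Space M] (hU : G.IsNormalNeighborhood p V U) {w : E →L[ℝ] ℝ} (hw : w ∈ V) :
    ∃ ψ : E →L[ℝ] ℝ, (∀ η, ψ (G.dexp p w η) = η (G.sharp p w)) ∧
      G.sharp (G.exp p w) ψ = G.dexp p w w := by
  obtain ⟨ξ, hξ, -, -⟩ := exists_momentum (hU.subset_expDomain hw)
  have h1 : (1 : ℝ) ∈ Icc (0 : ℝ) 1 := right_mem_Icc.2 zero_le_one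
  refine ⟨ξ 1, fun η => ?_, ?_⟩
  -- The pairing vanishes at s = 0, where the variation field is dexp_0(0), so its constant
  -- derivative is its value at s = 1.
  · have hd : ∀ s ∈ Icc (0 : ℝ) 1, HasDerivWithinAt
        (fun s => ξ s (G.dexp p (s • w) (s • η)) - s * η (G.sharp p w)) 0 (Icc 0 1) s := by
      intro s hs
      refine ((hU.hasDerivWithinAt_momentum_dexp hw hξ η hs).sub
        ((hasDerivAt_id s).mul_const (η (G.sharp p w))).hasDerivWithinAt).congr_deriv ?_
      simp
    have := constant_of_has_deriv_right_zero (fun s hs => (hd s hs).continuousWithinAt)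
      (fun s hs => (hd s (Ico_subset_Icc_self hs)).mono_of_mem_nhdsWithin
        (mem_of_superset (Icc_mem_nhdsGE hs.2) (Icc_subset_Icc_left hs.1))) 1 h1
    simp only [one_smul, zero_smul, map_zero, one_mul, zero_mul, sub_zero] at this
    linarith
  · have := hU.dexp_radial hw hξ h1
    rw [one_smul] at this
    exact this.symm

end IsNormalNeighborhood

end SubLorentzStructure

/-! ### Partitions -/

namespace IsPartition

variable {t : ℕ → ℝ} {N : ℕ} {a b : ℝ}

theorem mono (h : IsPartition t N a b) {i j : ℕ} (hij : i ≤ j) (hj : j ≤ N) : t i ≤ t j := by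
  induction j, hij using Nat.le_induction with
  | base => exact le_rfl
  | succ k hk ih => exact (ih (by omega)).trans (h.lt k (by omega)).le

theorem Icc_subset (h : IsPartition t N a b) {i : ℕ} (hi : i < N) :
    Icc (t i) (t (i + 1)) ⊆ Icc a b :=
  Icc_subset_Icc (h.left ▸ h.mono (Nat.zero_le i) hi.le) (h.right ▸ h.mono hi le_rfl)

theorem exists_right (h : IsPartition t N a b) {s : ℝ} (hs : s ∈ Ico a b) :
    ∃ i < N, t i ≤ s ∧ s < t (i + 1) := by
  classical
  have hex : ∃ k, s < t k := ⟨N, h.right ▸ hs.2⟩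
  have h0 : Nat.find hex ≠ 0 := fun h0 => by
    have := Nat.find_spec hex
    rw [h0, h.left] at this
    exact this.not_ge hs.1
  obtain ⟨i, hi⟩ := Nat.exists_eq_succ_of_ne_zero h0
  have hN : Nat.find hex ≤ N := Nat.find_min' hex (h.right ▸ hs.2)
  refine ⟨i, by omega, not_lt.1 (Nat.find_min hex (by omega)), ?_⟩
  have := Nat.find_spec hex
  rwa [hi] at this

theorem exists_left (h : IsPartition t N a b) {s : ℝ} (hs : s ∈ Ioc a b) :
    ∃ i < N, t i < s ∧ s ≤ t (i + 1) := by
  classical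
  have hex : ∃ k, s ≤ t k := ⟨N, h.right ▸ hs.2⟩
  have h0 : Nat.find hex ≠ 0 := fun h0 => by
    have := Nat.find_spec hex
    rw [h0, h.left] at this
    exact this.not_gt hs.1
  obtain ⟨i, hi⟩ := Nat.exists_eq_succ_of_ne_zero h0
  have hN : Nat.find hex ≤ N := Nat.find_min' hex (h.right ▸ hs.2)
  refine ⟨i, by omega, not_le.1 (Nat.find_min hex (by omega)), ?_⟩
  have := Nat.find_spec hex
  rwa [hi] at this

end IsPartition

namespace SubLorentzStructure

variable {E : Type u} [NormedAddCommGroup E] [NormedSpace ℝ E] [FiniteDimensional ℝ E]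
  {M : Type v} [TopologicalSpace M] [ChartedSpace E M] [IsManifold 𝓘(ℝ, E) ∞ M]

/-! ### Timelike vectors and the exponential map -/

/-- `SubLorentzStructure.pairing`, for vectors of the model space. -/
def form (G : SubLorentzStructure E M) (x : M) (v w : E) : ℝ := G.pairing x v w

/-- `SubLorentzStructure.TimelikeVector`, for vectors of the model space. -/
def Timelike (G : SubLorentzStructure E M) (x : M) (v : E) : Prop := G.TimelikeVector x v

theorem form_coe (G : SubLorentzStructure E M) (x : M) (v w : G.S x) :
    G.form x (v : TangentSpace 𝓘(ℝ, E) x) (w : TangentSpace 𝓘(ℝ, E) x) = G.Q x v w := by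
  have h : (v : TangentSpace 𝓘(ℝ, E) x) ∈ G.S x ∧ (w : TangentSpace 𝓘(ℝ, E) x) ∈ G.S x :=
    ⟨v.2, w.2⟩
  exact dif_pos h

theorem form_zero (G : SubLorentzStructure E M) (x : M) : G.form x 0 0 = 0 := by
  have := G.form_coe x 0 0
  rw [map_zero] at this
  exact this

theorem form_sharp (G : SubLorentzStructure E M) (x : M) (η : E →L[ℝ] ℝ) :
    G.form x (G.sharp x η) (G.sharp x η) = η (G.sharp x η) :=
  (G.form_coe x _ _).trans (G.Q_cometric_cometric x η)

theorem timelike_sharp_iff (G : SubLorentzStructure E M) (x : M) (η : E →L[ℝ] ℝ) :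
    G.Timelike x (G.sharp x η) ↔ η (G.sharp x η) < 0 := by
  rw [← G.form_sharp]
  exact ⟨fun h => h.2, fun h => ⟨(G.cometric x η).2, h⟩⟩

theorem Timelike.exists_coe {G : SubLorentzStructure E M} {x : M} {v : E} (h : G.Timelike x v) :
    ∃ u : G.S x, (u : TangentSpace 𝓘(ℝ, E) x) = v ∧ G.Q x u u < 0 :=
  ⟨⟨v, h.1⟩, rfl, (G.form_coe x ⟨v, h.1⟩ ⟨v, h.1⟩) ▸ h.2⟩

namespace IsNormalNeighborhood

variable [T2Space M] {G : SubLorentzStructure E M} {p : M} {V : Set (E →L[ℝ] ℝ)} {U : Set M}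

/-- The Gauss lemma, in terms of the form `Q`. -/
theorem exists_radial (hU : G.IsNormalNeighborhood p V U) {z : E →L[ℝ] ℝ} (hz : z ∈ V) :
    ∃ k : G.S (G.exp p z), (k : TangentSpace 𝓘(ℝ, E) (G.exp p z)) = G.dexp p z z ∧
      G.Q _ k k = z (G.sharp p z) ∧
      ∀ (u : E →L[ℝ] ℝ) (y : G.S (G.exp p z)),
        (y : TangentSpace 𝓘(ℝ, E) (G.exp p z)) = G.dexp p z u → G.Q _ y k = u (G.sharp p z) := by
  obtain ⟨ψ, h1, h2⟩ := hU.gauss hz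
  have h3 : ∀ (u : E →L[ℝ] ℝ) (y : G.S (G.exp p z)),
      (y : TangentSpace 𝓘(ℝ, E) (G.exp p z)) = G.dexp p z u →
        G.Q _ y (G.cometric (G.exp p z) ψ) = u (G.sharp p z) := by
    intro u y hy
    exact (G.Q_cometric (G.exp p z) ψ y).trans ((congrArg ψ hy).trans (h1 u))
  exact ⟨G.cometric _ ψ, h2, h3 z _ h2, h3⟩

/-- By the Gauss lemma this number is the product of two timelike vectors, dexp_z u and the radial
velocity. -/
theorem apply_sharp_ne_zero (hU : G.IsNormalNeighborhood p V U) {z u : E →L[ℝ] ℝ} (hz : z ∈ V)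
    (hN : z (G.sharp p z) < 0) (hu : G.Timelike (G.exp p z) (G.dexp p z u)) :
    u (G.sharp p z) ≠ 0 := by
  obtain ⟨k, -, hk2, hk3⟩ := hU.exists_radial hz
  obtain ⟨y, hy, hyy⟩ := hu.exists_coe
  rw [← hk3 u y hy]
  exact ne_zero_of_timelike (G.orthogonal_nonneg _) hyy (hk2 ▸ hN)

theorem apply_sharp_neg_of_corner (hU : G.IsNormalNeighborhood p V U) {z u u' : E →L[ℝ] ℝ}
    (hz : z ∈ V) (hN : z (G.sharp p z) < 0) (hu : G.Timelike (G.exp p z) (G.dexp p z u))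
    (hu' : G.Timelike (G.exp p z) (G.dexp p z u'))
    (h : G.form (G.exp p z) (G.dexp p z u) (G.dexp p z u') < 0) (hneg : u (G.sharp p z) < 0) :
    u' (G.sharp p z) < 0 := by
  obtain ⟨k, -, hk2, hk3⟩ := hU.exists_radial hz
  obtain ⟨y, hy, hyy⟩ := hu.exists_coe
  obtain ⟨y', hy', hyy'⟩ := hu'.exists_coe
  rw [← hk3 u' y' hy']
  refine timecone_trans (G.symm _) (G.orthogonal_nonneg _) hyy' hyy (hk2 ▸ hN) ?_
    (hk3 u y hy ▸ hneg)
  rw [(G.symm _).eq, ← form_coe, hy, hy']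
  exact h

/-- Reverse Cauchy-Schwarz for dexp_z u and the radial velocity, both products being given by the
Gauss lemma. The right-hand side is the derivative of the radius at z in the direction u. -/
theorem sqrt_form_le (hU : G.IsNormalNeighborhood p V U) {z u : E →L[ℝ] ℝ} (hz : z ∈ V)
    (hN : z (G.sharp p z) < 0) (hu : G.Timelike (G.exp p z) (G.dexp p z u))
    (hneg : u (G.sharp p z) < 0) :
    √|G.form (G.exp p z) (G.dexp p z u) (G.dexp p z u)| ≤
      -u (G.sharp p z) / √(-z (G.sharp p z)) := by
  obtain ⟨k, -, hk2, hk3⟩ := hU.exists_radial hz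
  obtain ⟨y, hy, hyy⟩ := hu.exists_coe
  have h1 := reverse_cauchySchwarz (G.symm _) (G.orthogonal_nonneg _) k hyy
  rw [hk2, hk3 u y hy] at h1
  have h2 : G.form (G.exp p z) (G.dexp p z u) (G.dexp p z u) = G.Q _ y y := by
    rw [← form_coe, hy]
  rw [h2, abs_of_neg hyy, le_div_iff₀ (Real.sqrt_pos.2 (by linarith)),
    ← Real.sqrt_mul (by linarith)]
  exact Real.sqrt_le_iff.2 ⟨by linarith, by nlinarith⟩

/-- Equality makes dexp_z u a multiple of dexp_z z, and injectivity of dexp_z at the timelike z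
carries this back to covectors. -/
theorem eq_smul_of_sqrt_form_eq (hU : G.IsNormalNeighborhood p V U) {z u : E →L[ℝ] ℝ}
    (hz : z ∈ V) (hN : z (G.sharp p z) < 0) (hu : G.Timelike (G.exp p z) (G.dexp p z u))
    (h : √|G.form (G.exp p z) (G.dexp p z u) (G.dexp p z u)| =
      -u (G.sharp p z) / √(-z (G.sharp p z))) :
    u = (u (G.sharp p z) / z (G.sharp p z)) • z := by
  obtain ⟨k, hk1, hk2, hk3⟩ := hU.exists_radial hz
  obtain ⟨y, hy, hyy⟩ := hu.exists_coe
  have h2 : G.form (G.exp p z) (G.dexp p z u) (G.dexp p z u) = G.Q _ y y := by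
    rw [← form_coe, hy]
  have hs : 0 < √(-z (G.sharp p z)) := Real.sqrt_pos.2 (by linarith)
  rw [h2, abs_of_neg hyy, eq_div_iff hs.ne'] at h
  have h3 := congrArg (· ^ 2) h
  simp only [mul_pow, Real.sq_sqrt (show 0 ≤ -G.Q _ y y by linarith),
    Real.sq_sqrt (show 0 ≤ -z (G.sharp p z) by linarith)] at h3
  have hky : G.Q _ k y = u (G.sharp p z) := by rw [(G.symm _).eq, hk3 u y hy]
  have h4 := eq_smul_of_reverse_cauchySchwarz_eq (G.symm _) (G.nondegenerate _)
    (G.orthogonal_nonneg _) (u := k) (y := y) (hk2 ▸ hN) (by rw [hk2, hky]; linarith)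
  rw [hky, hk2] at h4
  have h5 : G.dexp p z u = G.dexp p z ((u (G.sharp p z) / z (G.sharp p z)) • z) := by
    rw [map_smul, ← hk1, ← hy]
    exact congrArg Subtype.val h4
  exact hU.immersive z hz hN h5

/-- The velocity of the radial extremals has constant square. -/
theorem radial_velocity (hU : G.IsNormalNeighborhood p V U) {w : E →L[ℝ] ℝ} (hw : w ∈ V)
    (hN : w (G.sharp p w) < 0) {s : ℝ} (hs : s ∈ Icc (0 : ℝ) 1) :
    G.Timelike (G.exp p (s • w)) (G.dexp p (s • w) w) ∧
      G.form (G.exp p (s • w)) (G.dexp p (s • w) w) (G.dexp p (s • w) w) = w (G.sharp p w) := by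
  obtain ⟨ξ, hξ, hξ0, hp⟩ := exists_momentum (hU.subset_expDomain hw)
  have h := momentum_sharp hp hξ hξ0 hs
  rw [hU.dexp_radial hw hξ hs, timelike_sharp_iff, form_sharp, h]
  exact ⟨hN, rfl⟩

/-- The velocity of a curve of the form `exp ∘ w`. -/
theorem velocityWithin_lift (hU : G.IsNormalNeighborhood p V U) {c : ℝ → M}
    {w : ℝ → (E →L[ℝ] ℝ)} {K : Set ℝ} {s : ℝ} (hK : UniqueDiffWithinAt ℝ K s) (hws : w s ∈ V)
    (hw : DifferentiableWithinAt ℝ w K s) (hc : c =ᶠ[𝓝[K] s] fun s => G.exp p (w s))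
    (hcs : c s = G.exp p (w s)) :
    MDifferentiableWithinAt 𝓘(ℝ, ℝ) 𝓘(ℝ, E) c K s ∧
    (velocityWithin E c K s : E) = G.dexp p (w s) (derivWithin w K s) := by
  have h1 : HasMFDerivWithinAt 𝓘(ℝ, ℝ) 𝓘(ℝ, E →L[ℝ] ℝ) w K s (fderivWithin ℝ w K s) :=
    hw.hasFDerivWithinAt.hasMFDerivWithinAt
  have h2 : HasMFDerivAt 𝓘(ℝ, E →L[ℝ] ℝ) 𝓘(ℝ, E) (G.exp p) (w s) (G.dexp p (w s)) :=
    ((hU.contMDiffAt_exp hws).mdifferentiableAt (by simp)).hasMFDerivAt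
  have h3 := (h2.comp_hasMFDerivWithinAt s h1).congr_of_eventuallyEq hc hcs
  refine ⟨h3.mdifferentiableWithinAt, ?_⟩
  have h4 := h3.mfderivWithin hK.uniqueMDiffWithinAt
  exact congrArg (fun A : ℝ →L[ℝ] E => A 1) h4

end IsNormalNeighborhood

end SubLorentzStructure

/-! ### One-sided velocities -/

theorem Icc_mem_nhdsGE_of_mem_Ico {e d s : ℝ} (h : s ∈ Ico e d) : Icc e d ∈ 𝓝[≥] s :=
  mem_of_superset (Icc_mem_nhdsGE h.2) (Icc_subset_Icc_left h.1)

theorem Icc_mem_nhdsLE_of_mem_Ioc {e d s : ℝ} (h : s ∈ Ioc e d) : Icc e d ∈ 𝓝[≤] s :=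
  mem_of_superset (Icc_mem_nhdsLE h.1) (Icc_subset_Icc_right h.2)

theorem velocityWithin_eq_of_mem_nhdsWithin {E : Type u} [NormedAddCommGroup E] [NormedSpace ℝ E]
    {M : Type v} [TopologicalSpace M] [ChartedSpace E M] {c : ℝ → M} {J K : Set ℝ} {s : ℝ}
    (hc : MDifferentiableWithinAt 𝓘(ℝ, ℝ) 𝓘(ℝ, E) c J s) (hJ : J ∈ 𝓝[K] s)
    (hK : UniqueDiffWithinAt ℝ K s) : velocityWithin E c K s = velocityWithin E c J s := by
  unfold velocityWithin
  rw [(hc.hasMFDerivWithinAt.mono_of_mem_nhdsWithin hJ).mfderivWithin hK.uniqueMDiffWithinAt]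

theorem derivWithin_eq_of_mem_nhdsWithin {F : Type*} [NormedAddCommGroup F] [NormedSpace ℝ F]
    {w : ℝ → F} {J K : Set ℝ} {s : ℝ} (hw : DifferentiableWithinAt ℝ w J s) (hJ : J ∈ 𝓝[K] s)
    (hK : UniqueDiffWithinAt ℝ K s) :
    HasDerivWithinAt w (derivWithin w K s) K s ∧ derivWithin w K s = derivWithin w J s := by
  have h := hw.hasDerivWithinAt.mono_of_mem_nhdsWithin hJ
  have h2 := h.derivWithin hK
  exact ⟨h2 ▸ h, h2⟩

namespace SubLorentzStructure

variable {E : Type u} [NormedAddCommGroup E] [NormedSpace ℝ E] [FiniteDimensional ℝ E]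
  {M : Type v} [TopologicalSpace M] [ChartedSpace E M] [IsManifold 𝓘(ℝ, E) ∞ M]

/-! ### Lifts of timelike curves -/

/-- A curve `w` of covectors is smooth on `[e, d]`, and its image under the exponential map is
timelike. -/
structure IsTimelikeLiftOn (G : SubLorentzStructure E M) (p : M) (w : ℝ → (E →L[ℝ] ℝ))
    (e d : ℝ) : Prop where
  contDiffOn : ContDiffOn ℝ ∞ w (Icc e d)
  timelike : ∀ τ ∈ Icc e d, G.Timelike (G.exp p (w τ)) (G.dexp p (w τ) (derivWithin w (Icc e d) τ))

/-- The local properties of a lift to `V` of a timelike curve issuing from `p`. -/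
structure IsTimelikeLift (G : SubLorentzStructure E M) (p : M) (V : Set (E →L[ℝ] ℝ))
    (w : ℝ → (E →L[ℝ] ℝ)) (a b : ℝ) : Prop where
  lt : a < b
  mem : ∀ s ∈ Icc a b, w s ∈ V
  zero : w a = 0
  right : ∀ s ∈ Ico a b, ∃ d ∈ Ioc s b, G.IsTimelikeLiftOn p w s d
  left : ∀ s ∈ Ioc a b, ∃ e ∈ Ico a s, G.IsTimelikeLiftOn p w e s
  corner : ∀ s ∈ Ioo a b, G.form (G.exp p (w s)) (G.dexp p (w s) (derivWithin w (Iic s) s))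
    (G.dexp p (w s) (derivWithin w (Ici s) s)) < 0

namespace IsTimelikeLiftOn

variable {G : SubLorentzStructure E M} {p : M} {w : ℝ → (E →L[ℝ] ℝ)} {e d : ℝ}

theorem differentiableOn (h : G.IsTimelikeLiftOn p w e d) : DifferentiableOn ℝ w (Icc e d) :=
  h.contDiffOn.differentiableOn (by simp)

theorem continuousOn_derivWithin (h : G.IsTimelikeLiftOn p w e d) (hed : e < d) :
    ContinuousOn (derivWithin w (Icc e d)) (Icc e d) :=
  h.contDiffOn.continuousOn_derivWithin (uniqueDiffOn_Icc hed) (by simp)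

theorem hasDerivWithinAt_right (h : G.IsTimelikeLiftOn p w e d) {s : ℝ} (hs : s ∈ Ico e d) :
    HasDerivWithinAt w (derivWithin w (Ici s) s) (Ici s) s ∧
      derivWithin w (Ici s) s = derivWithin w (Icc e d) s :=
  derivWithin_eq_of_mem_nhdsWithin (h.differentiableOn s (Ico_subset_Icc_self hs))
    (Icc_mem_nhdsGE_of_mem_Ico hs) (uniqueDiffWithinAt_Ici s)

theorem hasDerivWithinAt_left (h : G.IsTimelikeLiftOn p w e d) {s : ℝ} (hs : s ∈ Ioc e d) :
    HasDerivWithinAt w (derivWithin w (Iic s) s) (Iic s) s ∧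
      derivWithin w (Iic s) s = derivWithin w (Icc e d) s :=
  derivWithin_eq_of_mem_nhdsWithin (h.differentiableOn s (Ioc_subset_Icc_self hs))
    (Icc_mem_nhdsLE_of_mem_Ioc hs) (uniqueDiffWithinAt_Iic s)

end IsTimelikeLiftOn

/-- The velocities on both sides of an interior point of a timelike curve are in the same
timecone. -/
theorem IsTimelikeCurve.corner {G : SubLorentzStructure E M} {c : ℝ → M} {a b : ℝ}
    (hc : G.IsTimelikeCurve c a b) {s : ℝ} (hs : s ∈ Ioo a b) :
    G.form (c s) (velocityWithin E c (Iic s) s) (velocityWithin E c (Ici s) s) < 0 := by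
  obtain ⟨-, N, t, ht, hsm, hcor⟩ := hc
  obtain ⟨i, hi, his, hsi⟩ := ht.exists_left (Ioo_subset_Ioc_self hs)
  have hd : ∀ i < N, ∀ τ ∈ Icc (t i) (t (i + 1)),
      MDifferentiableWithinAt 𝓘(ℝ, ℝ) 𝓘(ℝ, E) c (Icc (t i) (t (i + 1))) τ := fun i hi τ hτ =>
    ((hsm i hi).1 τ hτ).mdifferentiableWithinAt (by simp)
  rw [velocityWithin_eq_of_mem_nhdsWithin (hd i hi s ⟨his.le, hsi⟩)
    (Icc_mem_nhdsLE_of_mem_Ioc ⟨his, hsi⟩) (uniqueDiffWithinAt_Iic s)]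
  -- Inside a piece the one-sided velocities coincide and the claim is timelikeness; only at a break
  -- is the corner condition used.
  rcases hsi.lt_or_eq with h | h
  · rw [velocityWithin_eq_of_mem_nhdsWithin (hd i hi s ⟨his.le, hsi⟩)
      (Icc_mem_nhdsGE_of_mem_Ico ⟨his.le, h⟩) (uniqueDiffWithinAt_Ici s)]
    exact ((hsm i hi).2 s ⟨his.le, hsi⟩).2
  · have hi2 : i + 1 < N := by
      refine lt_of_le_of_ne hi fun h' => hs.2.ne ?_
      rw [h, h', ht.right]
    subst h
    rw [velocityWithin_eq_of_mem_nhdsWithin (hd (i + 1) hi2 _ (left_mem_Icc.2 (ht.lt _ hi2).le))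
      (Icc_mem_nhdsGE_of_mem_Ico ⟨le_rfl, ht.lt _ hi2⟩) (uniqueDiffWithinAt_Ici _)]
    exact hcor i hi2

/-- The curve and its lift may have different partitions. On each side of a point a short interval
lies in one piece of both, which replaces a common refinement. -/
theorem IsNormalNeighborhood.isTimelikeLift [T2Space M] {G : SubLorentzStructure E M} {p : M}
    {V : Set (E →L[ℝ] ℝ)} {U : Set M} (hU : G.IsNormalNeighborhood p V U) {c : ℝ → M} {a b : ℝ}
    (hc : G.IsTimelikeCurve c a b) {w : ℝ → (E →L[ℝ] ℝ)} (hw : IsPiecewiseSmooth w a b)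
    (hw0 : w a = 0) (hwc : ∀ s ∈ Icc a b, w s ∈ V ∧ G.exp p (w s) = c s) :
    G.IsTimelikeLift p V w a b := by
  have hcorner := fun s (hs : s ∈ Ioo a b) => hc.corner hs
  obtain ⟨hab, N, t, ht, hsm, -⟩ := hc
  obtain ⟨N', t', ht', hsm'⟩ := hw
  have key : ∀ i < N, ∀ j < N', ∀ e d, e < d → Icc e d ⊆ Icc (t i) (t (i + 1)) →
      Icc e d ⊆ Icc (t' j) (t' (j + 1)) → G.IsTimelikeLiftOn p w e d := by
    intro i hi j hj e d hed hci hwj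
    have hws : ContDiffOn ℝ ∞ w (Icc e d) := (hsm' j hj).mono hwj
    refine ⟨hws, fun τ hτ => ?_⟩
    have hsub : Icc e d ⊆ Icc a b := hci.trans (ht.Icc_subset hi)
    have hu := uniqueDiffOn_Icc hed τ hτ
    have h1 := (hU.velocityWithin_lift hu (hwc τ (hsub hτ)).1
      (hws.differentiableOn (by simp) τ hτ) (eventually_mem_nhdsWithin.mono fun σ hσ =>
        (hwc σ (hsub hσ)).2.symm) (hwc τ (hsub hτ)).2.symm).2
    have h2 := velocityWithin_eq_of_mem_nhdsWithin
      (((hsm i hi).1 τ (hci hτ)).mdifferentiableWithinAt (by simp))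
      (mem_of_superset self_mem_nhdsWithin hci) hu
    have h3 : G.Timelike (c τ) (velocityWithin E c (Icc e d) τ) := by
      rw [h2]; exact (hsm i hi).2 τ (hci hτ)
    rw [h1, ← (hwc τ (hsub hτ)).2] at h3
    exact h3
  have hright : ∀ s ∈ Ico a b, ∃ d ∈ Ioc s b, G.IsTimelikeLiftOn p w s d := by
    intro s hs
    obtain ⟨i, hi, h1, h2⟩ := ht.exists_right hs
    obtain ⟨j, hj, h3, h4⟩ := ht'.exists_right hs
    refine ⟨min (t (i + 1)) (t' (j + 1)), ⟨lt_min h2 h4, min_le_of_left_le ?_⟩,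
      key i hi j hj _ _ (lt_min h2 h4) (Icc_subset_Icc h1 (min_le_left _ _))
        (Icc_subset_Icc h3 (min_le_right _ _))⟩
    exact (ht.Icc_subset hi (right_mem_Icc.2 (h1.trans h2.le))).2
  have hleft : ∀ s ∈ Ioc a b, ∃ e ∈ Ico a s, G.IsTimelikeLiftOn p w e s := by
    intro s hs
    obtain ⟨i, hi, h1, h2⟩ := ht.exists_left hs
    obtain ⟨j, hj, h3, h4⟩ := ht'.exists_left hs
    refine ⟨max (t i) (t' j), ⟨le_max_of_le_left ?_, max_lt h1 h3⟩,
      key i hi j hj _ _ (max_lt h1 h3) (Icc_subset_Icc (le_max_left _ _) h2)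
        (Icc_subset_Icc (le_max_right _ _) h4)⟩
    exact (ht.Icc_subset hi (left_mem_Icc.2 (h1.le.trans h2))).1
  refine ⟨hab, fun s hs => (hwc s hs).1, hw0, hright, hleft, fun s hs => ?_⟩
  obtain ⟨d, hd, hdw⟩ := hright s (Ioo_subset_Ico_self hs)
  obtain ⟨e, he, hew⟩ := hleft s (Ioo_subset_Ioc_self hs)
  have hsI := Ioo_subset_Icc_self hs
  have hev : ∀ K : Set ℝ, c =ᶠ[𝓝[K] s] fun s => G.exp p (w s) := fun K => by
    filter_upwards [nhdsWithin_le_nhds (Icc_mem_nhds hs.1 hs.2)] with σ hσ using (hwc σ hσ).2.symm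
  have h1 := (hU.velocityWithin_lift (uniqueDiffWithinAt_Iic s) (hwc s hsI).1
    (hew.hasDerivWithinAt_left ⟨he.2, le_rfl⟩).1.differentiableWithinAt (hev _)
    (hwc s hsI).2.symm).2
  have h2 := (hU.velocityWithin_lift (uniqueDiffWithinAt_Ici s) (hwc s hsI).1
    (hdw.hasDerivWithinAt_right ⟨le_rfl, hd.1⟩).1.differentiableWithinAt (hev _)
    (hwc s hsI).2.symm).2
  have h3 := hcorner s hs
  rw [h1, h2, ← (hwc s hsI).2] at h3
  exact h3

namespace IsTimelikeLift

variable {G : SubLorentzStructure E M} {p : M} {V : Set (E →L[ℝ] ℝ)} {U : Set M}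
  {w : ℝ → (E →L[ℝ] ℝ)} {a b : ℝ}

theorem hasDerivWithinAt_Ici (h : G.IsTimelikeLift p V w a b) {s : ℝ} (hs : s ∈ Ico a b) :
    HasDerivWithinAt w (derivWithin w (Ici s) s) (Ici s) s := by
  obtain ⟨d, hd, hw⟩ := h.right s hs
  exact (hw.hasDerivWithinAt_right ⟨le_rfl, hd.1⟩).1

theorem timelike_Ici (h : G.IsTimelikeLift p V w a b) {s : ℝ} (hs : s ∈ Ico a b) :
    G.Timelike (G.exp p (w s)) (G.dexp p (w s) (derivWithin w (Ici s) s)) := by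
  obtain ⟨d, hd, hw⟩ := h.right s hs
  rw [(hw.hasDerivWithinAt_right ⟨le_rfl, hd.1⟩).2]
  exact hw.timelike s (left_mem_Icc.2 hd.1.le)

theorem timelike_Iic (h : G.IsTimelikeLift p V w a b) {s : ℝ} (hs : s ∈ Ioc a b) :
    G.Timelike (G.exp p (w s)) (G.dexp p (w s) (derivWithin w (Iic s) s)) := by
  obtain ⟨e, he, hw⟩ := h.left s hs
  rw [(hw.hasDerivWithinAt_left ⟨he.2, le_rfl⟩).2]
  exact hw.timelike s (right_mem_Icc.2 he.2.le)

theorem continuousOn (h : G.IsTimelikeLift p V w a b) : ContinuousOn w (Icc a b) := by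
  intro s hs
  have h1 : ContinuousWithinAt w (Icc s b) s := by
    rcases hs.2.lt_or_eq with hsb | hsb
    · exact (h.hasDerivWithinAt_Ici ⟨hs.1, hsb⟩).continuousWithinAt.mono Icc_subset_Ici_self
    · rw [hsb, Icc_self]; exact continuousWithinAt_singleton
  have h2 : ContinuousWithinAt w (Icc a s) s := by
    rcases hs.1.lt_or_eq with hsa | hsa
    · obtain ⟨e, he, hw⟩ := h.left s ⟨hsa, hs.2⟩
      exact (hw.hasDerivWithinAt_left ⟨he.2, le_rfl⟩).1.continuousWithinAt.mono Icc_subset_Iic_self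
    · rw [hsa, Icc_self]; exact continuousWithinAt_singleton
  have := h2.union h1
  rwa [Icc_union_Icc_eq_Icc hs.1 hs.2] at this

end IsTimelikeLift

end SubLorentzStructure

namespace SubLorentzStructure

variable {E : Type u} [NormedAddCommGroup E] [NormedSpace ℝ E] [FiniteDimensional ℝ E]
  {M : Type v} [TopologicalSpace M] [ChartedSpace E M] [IsManifold 𝓘(ℝ, E) ∞ M]

/-! ### Timelike lifts stay in the timecone -/

theorem continuous_apply_sharp (G : SubLorentzStructure E M) (p : M) :
    Continuous fun z : (E →L[ℝ] ℝ) × (E →L[ℝ] ℝ) => z.1 (G.sharp p z.2) :=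
  continuous_fst.clm_apply ((G.sharp p).continuous.comp continuous_snd)

theorem hasDerivWithinAt_apply_sharp (G : SubLorentzStructure E M) (p : M)
    {w : ℝ → (E →L[ℝ] ℝ)} {w' : E →L[ℝ] ℝ} {K : Set ℝ} {s : ℝ} (h : HasDerivWithinAt w w' K s) :
    HasDerivWithinAt (fun τ => w τ (G.sharp p (w τ))) (2 * w' (G.sharp p (w s))) K s := by
  refine (h.clm_apply ((G.sharp p).hasFDerivAt.comp_hasDerivWithinAt s h)).congr_deriv ?_
  rw [G.apply_sharp_comm p (w s) w', Function.comp_apply]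
  ring

namespace IsTimelikeLift

variable {G : SubLorentzStructure E M} {p : M} {V : Set (E →L[ℝ] ℝ)} {U : Set M}
  {w : ℝ → (E →L[ℝ] ℝ)} {a b : ℝ}

/-- Since dexp_0 = g_p, the initial velocity u of the lift is a timelike covector. As w(s)/(s - a)
and w'(s) both tend to u, the two expressions, divided by (s - a)² and s - a, tend to ⟨u, g_p u⟩ <
0. -/
theorem eventually_neg [T2Space M] (hU : G.IsNormalNeighborhood p V U)
    (h : G.IsTimelikeLift p V w a b) :
    ∀ᶠ s in 𝓝[>] a, w s (G.sharp p (w s)) < 0 ∧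
      derivWithin w (Ici s) s (G.sharp p (w s)) < 0 := by
  obtain ⟨d, hd, hw⟩ := h.right a ⟨le_rfl, h.lt⟩
  have had : a ∈ Icc a d := left_mem_Icc.2 hd.1.le
  set u := derivWithin w (Icc a d) a with hu
  have hneg : u (G.sharp p u) < 0 := by
    have := hw.timelike a had
    rwa [h.zero, hU.dexp_zero, hU.exp_zero, timelike_sharp_iff] at this
  have hle : 𝓝[>] a ≤ 𝓝[Icc a d] a :=
    nhdsWithin_le_of_mem (mem_of_superset (Ioc_mem_nhdsGT hd.1) Ioc_subset_Icc_self)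
  have hder : Tendsto (derivWithin w (Icc a d)) (𝓝[>] a) (𝓝 u) :=
    (hw.continuousOn_derivWithin hd.1 a had).mono_left hle
  have hslope : Tendsto (fun s => (s - a)⁻¹ • w s) (𝓝[>] a) (𝓝 u) := by
    have h1 := (hw.hasDerivWithinAt_right ⟨le_rfl, hd.1⟩)
    have h2 := (h1.2 ▸ h1.1).mono Ioi_subset_Ici_self
    rw [hasDerivWithinAt_iff_tendsto_slope' self_notMem_Ioi] at h2
    simpa [slope_fun_def, h.zero] using h2
  have hc := (G.continuous_apply_sharp p).tendsto (u, u)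
  have e1 := (hc.comp (hslope.prodMk_nhds hslope)).eventually (gt_mem_nhds hneg)
  have e2 := (hc.comp (hder.prodMk_nhds hslope)).eventually (gt_mem_nhds hneg)
  filter_upwards [e1, e2, Ioo_mem_nhdsGT hd.1] with s h1 h2 hs
  have hsa : 0 < (s - a)⁻¹ := inv_pos.2 (sub_pos.2 hs.1)
  simp only [Function.comp_apply, map_smul, smul_apply, smul_eq_mul]
    at h1 h2
  refine ⟨?_, ?_⟩
  · rw [← mul_assoc] at h1
    exact neg_of_mul_neg_right h1 (by positivity)
  · rw [(hw.hasDerivWithinAt_right ⟨hs.1.le, hs.2⟩).2]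
    exact neg_of_mul_neg_right h2 hsa.le

/-- The two inequalities support each other: ⟨w', g w⟩ < 0 makes ⟨w, g w⟩ decrease, and while w is
timelike ⟨w', g w⟩ cannot vanish. The induction starts at some a' > a, since w(a) = 0 is not
timelike. -/
theorem neg [T2Space M] (hU : G.IsNormalNeighborhood p V U) (h : G.IsTimelikeLift p V w a b) :
    ∀ s ∈ Ioc a b, w s (G.sharp p (w s)) < 0 ∧
      (s < b → derivWithin w (Ici s) s (G.sharp p (w s)) < 0) := by
  intro s hs
  obtain ⟨a', ⟨ha1, ha2⟩, ha'⟩ := ((h.eventually_neg hU).and (Ioo_mem_nhdsGT hs.1)).exists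
  refine Icc_induction (a := a') (b := b) (P := fun s => w s (G.sharp p (w s)) < 0 ∧
    (s < b → derivWithin w (Ici s) s (G.sharp p (w s)) < 0)) ⟨ha1, fun _ => ha2⟩ ?_ ?_ s
    ⟨ha'.2.le, hs.2⟩
  · intro x hx hPx
    obtain ⟨d, hd, hw⟩ := h.right x ⟨ha'.1.le.trans hx.1, hx.2⟩
    have hxd : x ∈ Icc x d := left_mem_Icc.2 hd.1.le
    have hle : 𝓝[>] x ≤ 𝓝[Icc x d] x :=
      nhdsWithin_le_of_mem (mem_of_superset (Ioc_mem_nhdsGT hd.1) Ioc_subset_Icc_self)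
    have hwc : Tendsto w (𝓝[>] x) (𝓝 (w x)) := (hw.contDiffOn.continuousOn x hxd).mono_left hle
    have hder : Tendsto (derivWithin w (Icc x d)) (𝓝[>] x) (𝓝 (derivWithin w (Icc x d) x)) :=
      (hw.continuousOn_derivWithin hd.1 x hxd).mono_left hle
    have h2 := hPx.2 hx.2
    rw [(hw.hasDerivWithinAt_right ⟨le_rfl, hd.1⟩).2] at h2
    have e1 := (((G.continuous_apply_sharp p).tendsto (w x, w x)).comp
      (hwc.prodMk_nhds hwc)).eventually (gt_mem_nhds hPx.1)
    have e2 := (((G.continuous_apply_sharp p).tendsto (derivWithin w (Icc x d) x, w x)).comp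
      (hder.prodMk_nhds hwc)).eventually (gt_mem_nhds h2)
    filter_upwards [e1, e2, Ioo_mem_nhdsGT hd.1] with y h3 h4 hy
    refine ⟨h3, fun _ => ?_⟩
    rw [(hw.hasDerivWithinAt_right ⟨hy.1.le, hy.2⟩).2]
    exact h4
  · intro x hx hP
    have hxI : x ∈ Ioc a b := ⟨ha'.1.trans hx.1, hx.2⟩
    obtain ⟨e, he, hw⟩ := h.left x hxI
    set m := max a' e with hm
    have hmx : m < x := max_lt hx.1 he.2
    have hmP : ∀ y ∈ Ico m x, y ∈ Ico e x ∧ w y (G.sharp p (w y)) < 0 ∧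
        derivWithin w (Ici y) y (G.sharp p (w y)) < 0 := fun y hy => by
      have := hP y ⟨(le_max_left _ _).trans hy.1, hy.2⟩
      exact ⟨⟨(le_max_right _ _).trans hy.1, hy.2⟩, this.1, this.2 (hy.2.trans_le hx.2)⟩
    have hcont : ContinuousOn (fun τ => w τ (G.sharp p (w τ))) (Icc m x) := by
      have : ContinuousOn w (Icc m x) := h.continuousOn.mono
        (Icc_subset_Icc (ha'.1.le.trans (le_max_left _ _)) hx.2)
      exact (G.continuous_apply_sharp p).comp_continuousOn (this.prodMk this)
    -- ⟨w, g w⟩ is nonincreasing on [m, x] by the sign of its right derivative, so it remains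
    -- negative in the limit.
    have hN : w x (G.sharp p (w x)) < 0 := by
      have h1 := image_le_of_deriv_right_le_deriv_boundary hcont
        (fun y hy => G.hasDerivWithinAt_apply_sharp p
          (hw.hasDerivWithinAt_right (hmP y hy).1).1)
        (B := fun _ => w m (G.sharp p (w m))) (B' := fun _ => 0) le_rfl continuousOn_const
        (fun y _ => hasDerivWithinAt_const _ _ _)
        (fun y hy => by have := (hmP y hy).2.2; linarith) (right_mem_Icc.2 hmx.le)
      exact h1.trans_lt (hmP m ⟨le_rfl, hmx⟩).2.1
    refine ⟨hN, fun hxb => ?_⟩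
    have hxe : x ∈ Icc e x := right_mem_Icc.2 he.2.le
    have hle : 𝓝[<] x ≤ 𝓝[Icc e x] x :=
      nhdsWithin_le_of_mem (mem_of_superset (Ico_mem_nhdsLT he.2) Ico_subset_Icc_self)
    have hder : Tendsto (derivWithin w (Icc e x)) (𝓝[<] x) (𝓝 (derivWithin w (Icc e x) x)) :=
      (hw.continuousOn_derivWithin he.2 x hxe).mono_left hle
    have hwc : Tendsto w (𝓝[<] x) (𝓝 (w x)) := (hw.contDiffOn.continuousOn x hxe).mono_left hle
    have hlim := ((G.continuous_apply_sharp p).tendsto (derivWithin w (Icc e x) x, w x)).comp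
      (hder.prodMk_nhds hwc)
    have hle0 : derivWithin w (Icc e x) x (G.sharp p (w x)) ≤ 0 := by
      refine le_of_tendsto hlim ?_
      filter_upwards [Ico_mem_nhdsLT hmx] with y hy
      have := (hmP y hy).2.2
      rw [(hw.hasDerivWithinAt_right (hmP y hy).1).2] at this
      exact this.le
    rw [← (hw.hasDerivWithinAt_left ⟨he.2, le_rfl⟩).2] at hle0
    have hxV := h.mem x (Ioc_subset_Icc_self hxI)
    have hT := h.timelike_Iic hxI
    -- The limit from the left gives only ≤ 0; timelikeness of the left velocity makes it strict,
    -- and the corner condition passes it to the right velocity.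
    have hlt := lt_of_le_of_ne hle0 (hU.apply_sharp_ne_zero hxV hN hT)
    exact hU.apply_sharp_neg_of_corner hxV hN hT (h.timelike_Ici ⟨hxI.1.le, hxb⟩)
      (h.corner x ⟨hxI.1, hxb⟩) hlt

/-! ### The radial function along a timelike lift -/

/-- The radial function `(-⟨g z, z⟩)^{1/2}`. -/
def _root_.SubLorentzStructure.radius (G : SubLorentzStructure E M) (p : M)
    (z : E →L[ℝ] ℝ) : ℝ := √(-z (G.sharp p z))

theorem radius_zero (h : G.IsTimelikeLift p V w a b) : G.radius p (w a) = 0 := by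
  simp [radius, h.zero]

theorem continuousOn_radius (h : G.IsTimelikeLift p V w a b) :
    ContinuousOn (fun s => G.radius p (w s)) (Icc a b) :=
  Real.continuous_sqrt.comp_continuousOn
    ((G.continuous_apply_sharp p).comp_continuousOn (h.continuousOn.prodMk h.continuousOn)).neg

theorem radius_pos [T2Space M] (hU : G.IsNormalNeighborhood p V U)
    (h : G.IsTimelikeLift p V w a b) {s : ℝ} (hs : s ∈ Ioc a b) : 0 < G.radius p (w s) :=
  Real.sqrt_pos.2 (neg_pos.2 (h.neg hU s hs).1)

theorem hasDerivWithinAt_radius [T2Space M] (hU : G.IsNormalNeighborhood p V U)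
    (h : G.IsTimelikeLift p V w a b) {s : ℝ} (hs : s ∈ Ioo a b) :
    HasDerivWithinAt (fun s => G.radius p (w s))
      (-derivWithin w (Ici s) s (G.sharp p (w s)) / G.radius p (w s)) (Ioi s) s := by
  have h1 := (G.hasDerivWithinAt_apply_sharp p ((h.hasDerivWithinAt_Ici
    (Ioo_subset_Ico_self hs)).mono Ioi_subset_Ici_self)).neg
  have hN := (h.neg hU s (Ioo_subset_Ioc_self hs)).1
  refine (h1.sqrt (neg_pos.2 hN).ne').congr_deriv ?_
  rw [radius, ← mul_neg, mul_div_mul_left _ _ two_ne_zero]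
  rfl

theorem radius_deriv_pos [T2Space M] (hU : G.IsNormalNeighborhood p V U)
    (h : G.IsTimelikeLift p V w a b) {s : ℝ} (hs : s ∈ Ioo a b) :
    0 < -derivWithin w (Ici s) s (G.sharp p (w s)) / G.radius p (w s) :=
  div_pos (neg_pos.2 ((h.neg hU s (Ioo_subset_Ioc_self hs)).2 hs.2))
    (h.radius_pos hU (Ioo_subset_Ioc_self hs))

/-- No bound near a is needed, where the denominator tends to zero: a nonnegative right derivative
of a continuous function is integrable. -/
theorem intervalIntegrable_radius_deriv [T2Space M] (hU : G.IsNormalNeighborhood p V U)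
    (h : G.IsTimelikeLift p V w a b) {x y : ℝ} (hx : a ≤ x) (hxy : x ≤ y) (hy : y ≤ b) :
    IntervalIntegrable (fun s => -derivWithin w (Ici s) s (G.sharp p (w s)) / G.radius p (w s))
      volume x y := by
  rw [intervalIntegrable_iff_integrableOn_Ioc_of_le hxy]
  exact (intervalIntegral.integrableOn_deriv_right_of_nonneg h.continuousOn_radius
    (fun s hs => h.hasDerivWithinAt_radius hU hs)
    (fun s hs => (h.radius_deriv_pos hU hs).le)).mono_set (Ioc_subset_Ioc hx hy)

theorem integral_radius_deriv [T2Space M] (hU : G.IsNormalNeighborhood p V U)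
    (h : G.IsTimelikeLift p V w a b) {x y : ℝ} (hx : a ≤ x) (hxy : x ≤ y) (hy : y ≤ b) :
    ∫ s in x..y, -derivWithin w (Ici s) s (G.sharp p (w s)) / G.radius p (w s) =
      G.radius p (w y) - G.radius p (w x) :=
  intervalIntegral.integral_eq_sub_of_hasDeriv_right_of_le hxy
    (h.continuousOn_radius.mono (Icc_subset_Icc hx hy))
    (fun _ hs => h.hasDerivWithinAt_radius hU ⟨hx.trans_lt hs.1, hs.2.trans_le hy⟩)
    (h.intervalIntegrable_radius_deriv hU hx hxy hy)

theorem strictMonoOn_radius [T2Space M] (hU : G.IsNormalNeighborhood p V U)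
    (h : G.IsTimelikeLift p V w a b) :
    StrictMonoOn (fun s => G.radius p (w s)) (Icc a b) := by
  intro x hx y hy hxy
  have h1 := intervalIntegral.intervalIntegral_pos_of_pos_on
    (h.intervalIntegrable_radius_deriv hU hx.1 hxy.le hy.2)
    (fun s hs => h.radius_deriv_pos hU ⟨hx.1.trans_lt hs.1, hs.2.trans_le hy.2⟩) hxy
  rw [h.integral_radius_deriv hU hx.1 hxy.le hy.2] at h1
  exact sub_pos.1 h1

/-- If the velocity of the lift is radial almost everywhere, then the lift is radial. -/
theorem eq_smul_of_ae_radial [T2Space M] (hU : G.IsNormalNeighborhood p V U)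
    (h : G.IsTimelikeLift p V w a b)
    (hae : ∀ᵐ s, s ∈ Ioo a b → derivWithin w (Ici s) s =
      (derivWithin w (Ici s) s (G.sharp p (w s)) / w s (G.sharp p (w s))) • w s)
    {s : ℝ} (hs : s ∈ Icc a b) :
    w s = (G.radius p (w s) / G.radius p (w b)) • w b := by
  have hb : b ∈ Ioc a b := ⟨h.lt, le_rfl⟩
  rcases hs.1.eq_or_lt with has | has
  · rw [← has, h.radius_zero, h.zero, zero_div, zero_smul]
  have hsub : Icc s b ⊆ Ioc a b := fun τ hτ => ⟨has.trans_le hτ.1, hτ.2⟩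
  have hpos := fun τ (hτ : τ ∈ Icc s b) => h.radius_pos hU (hsub hτ)
  have hcont : ContinuousOn (fun τ => (G.radius p (w τ))⁻¹ • w τ) (Icc s b) :=
    ((h.continuousOn_radius.mono (Icc_subset_Icc_left hs.1)).inv₀
      fun τ hτ => (hpos τ hτ).ne').smul (h.continuousOn.mono (Icc_subset_Icc_left hs.1))
  -- The derivative of w / r(w) is the part of w' that is g-orthogonal to w, divided by r(w). It
  -- vanishes almost everywhere by `hae`, so w / r(w) is constant.
  have hder : ∀ τ ∈ Ioo s b, HasDerivWithinAt (fun τ => (G.radius p (w τ))⁻¹ • w τ)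
      ((G.radius p (w τ))⁻¹ • (derivWithin w (Ici τ) τ -
        (derivWithin w (Ici τ) τ (G.sharp p (w τ)) / w τ (G.sharp p (w τ))) • w τ))
      (Ioi τ) τ := by
    intro τ hτ
    have hτ' : τ ∈ Ioo a b := ⟨has.trans hτ.1, hτ.2⟩
    have h1 := (h.hasDerivWithinAt_radius hU hτ').fun_inv (hpos τ (Ioo_subset_Icc_self hτ)).ne'
    have h2 := (h.hasDerivWithinAt_Ici (Ioo_subset_Ico_self hτ')).mono Ioi_subset_Ici_self
    refine (h1.smul h2).congr_deriv ?_
    have hN := (h.neg hU τ (Ioo_subset_Ioc_self hτ')).1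
    have hr : G.radius p (w τ) ^ 2 = -w τ (G.sharp p (w τ)) :=
      Real.sq_sqrt (neg_pos.2 hN).le
    have hcoef : -(-derivWithin w (Ici τ) τ (G.sharp p (w τ)) / G.radius p (w τ)) /
        G.radius p (w τ) ^ 2 = -((G.radius p (w τ))⁻¹ *
        (derivWithin w (Ici τ) τ (G.sharp p (w τ)) / w τ (G.sharp p (w τ)))) := by
      rw [hr]
      field_simp
    rw [smul_sub, smul_smul, hcoef, neg_smul, sub_eq_add_neg]
  have hae' : (fun τ => (G.radius p (w τ))⁻¹ • (derivWithin w (Ici τ) τ -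
      (derivWithin w (Ici τ) τ (G.sharp p (w τ)) / w τ (G.sharp p (w τ))) • w τ))
      =ᵐ[volume.restrict (Ioc s b)] 0 := by
    have hnb : ∀ᵐ τ : ℝ, τ ≠ b := by simp [ae_iff]
    rw [Filter.EventuallyEq, ae_restrict_iff' measurableSet_Ioc]
    filter_upwards [hae, hnb] with τ h1 h2 h3
    have := h1 ⟨has.trans h3.1, h3.2.lt_of_ne h2⟩
    rw [sub_eq_zero.2 this, smul_zero]
    rfl
  have hint : IntervalIntegrable (fun τ => (G.radius p (w τ))⁻¹ • (derivWithin w (Ici τ) τ -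
      (derivWithin w (Ici τ) τ (G.sharp p (w τ)) / w τ (G.sharp p (w τ))) • w τ))
      volume s b := by
    rw [intervalIntegrable_iff_integrableOn_Ioc_of_le hs.2]
    exact (integrable_zero _ _ _).congr hae'.symm
  have hFTC := intervalIntegral.integral_eq_sub_of_hasDeriv_right_of_le hs.2 hcont hder hint
  rw [intervalIntegral.integral_of_le hs.2, integral_congr_ae hae'] at hFTC
  have heq : (G.radius p (w b))⁻¹ • w b = (G.radius p (w s))⁻¹ • w s :=
    sub_eq_zero.1 (by simpa using hFTC.symm)
  rw [div_eq_mul_inv, mul_smul, heq, smul_smul,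
    mul_inv_cancel₀ (hpos s (left_mem_Icc.2 hs.2)).ne', one_smul]

end IsTimelikeLift

end SubLorentzStructure

namespace SubLorentzStructure

variable {E : Type u} [NormedAddCommGroup E] [NormedSpace ℝ E] [FiniteDimensional ℝ E]
  {M : Type v} [TopologicalSpace M] [ChartedSpace E M] [IsManifold 𝓘(ℝ, E) ∞ M]

theorem sigma_mk_congr {x y : M} {ξ ζ : E →L[ℝ] ℝ} (hx : x = y) (hξ : ξ = ζ) :
    (⟨x, ξ⟩ : Σ x : M, CotangentSpace E x) = ⟨y, ζ⟩ := by
  subst hx hξ; rfl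

/-! ### Comparison of lengths -/

/-- The speed of a curve, i.e. the integrand of `SubLorentzStructure.length`. -/
def speed (G : SubLorentzStructure E M) (c : ℝ → M) (s : ℝ) : ℝ :=
  √|G.form (c s) (velocityWithin E c univ s) (velocityWithin E c univ s)|

theorem length_eq_integral_speed (G : SubLorentzStructure E M) (c : ℝ → M) (a b : ℝ) :
    G.length c a b = ∫ s in a..b, G.speed c s := rfl

namespace IsTimelikeLift

variable [T2Space M] {G : SubLorentzStructure E M} {p : M} {V : Set (E →L[ℝ] ℝ)} {U : Set M}
  {c : ℝ → M} {w : ℝ → (E →L[ℝ] ℝ)} {a b : ℝ}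

/-- The length uses the two-sided velocity, which has default value 0 where c is not differentiable.
Elsewhere it equals the right velocity. Either way the speed is bounded by the derivative of the
radius. -/
theorem speed_cases (hU : G.IsNormalNeighborhood p V U) (h : G.IsTimelikeLift p V w a b)
    (hc : ∀ s ∈ Icc a b, G.exp p (w s) = c s) {s : ℝ} (hs : s ∈ Ioo a b) :
    G.speed c s = 0 ∨ G.speed c s = √|G.form (G.exp p (w s))
      (G.dexp p (w s) (derivWithin w (Ici s) s)) (G.dexp p (w s) (derivWithin w (Ici s) s))| := by
  have hsI := Ioo_subset_Icc_self hs
  by_cases hd : MDifferentiableWithinAt 𝓘(ℝ, ℝ) 𝓘(ℝ, E) c univ s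
  · right
    have hev : c =ᶠ[𝓝[Ici s] s] fun s => G.exp p (w s) := by
      filter_upwards [nhdsWithin_le_nhds (Icc_mem_nhds hs.1 hs.2)] with σ hσ using (hc σ hσ).symm
    have h1 := (hU.velocityWithin_lift (uniqueDiffWithinAt_Ici s) (h.mem s hsI)
      (h.hasDerivWithinAt_Ici (Ioo_subset_Ico_self hs)).differentiableWithinAt hev
      (hc s hsI).symm).2
    rw [velocityWithin_eq_of_mem_nhdsWithin hd univ_mem (uniqueDiffWithinAt_Ici s)] at h1
    rw [speed, h1, hc s hsI]
  · left
    have h0 : (velocityWithin E c univ s : E) = 0 := by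
      unfold velocityWithin
      rw [mfderivWithin_zero_of_not_mdifferentiableWithinAt hd]
      rfl
    have h1 : G.form (c s) (velocityWithin E c univ s) (velocityWithin E c univ s) =
        G.form (c s) (0 : E) (0 : E) := congrArg₂ (G.form (c s)) h0 h0
    rw [speed, h1, form_zero, abs_zero, Real.sqrt_zero]

theorem sqrt_form_le_radius_deriv (hU : G.IsNormalNeighborhood p V U)
    (h : G.IsTimelikeLift p V w a b) {s : ℝ} (hs : s ∈ Ioo a b) :
    √|G.form (G.exp p (w s)) (G.dexp p (w s) (derivWithin w (Ici s) s))
      (G.dexp p (w s) (derivWithin w (Ici s) s))| ≤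
      -derivWithin w (Ici s) s (G.sharp p (w s)) / G.radius p (w s) :=
  have hN := h.neg hU s (Ioo_subset_Ioc_self hs)
  hU.sqrt_form_le (h.mem s (Ioo_subset_Icc_self hs)) hN.1 (h.timelike_Ici (Ioo_subset_Ico_self hs))
    (hN.2 hs.2)

theorem speed_le (hU : G.IsNormalNeighborhood p V U) (h : G.IsTimelikeLift p V w a b)
    (hc : ∀ s ∈ Icc a b, G.exp p (w s) = c s) {s : ℝ} (hs : s ∈ Ioo a b) :
    G.speed c s ≤ -derivWithin w (Ici s) s (G.sharp p (w s)) / G.radius p (w s) := by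
  rcases h.speed_cases hU hc hs with h0 | h0
  · rw [h0]; exact (h.radius_deriv_pos hU hs).le
  · rw [h0]; exact h.sqrt_form_le_radius_deriv hU hs

theorem length_le_radius (hU : G.IsNormalNeighborhood p V U) (h : G.IsTimelikeLift p V w a b)
    (hc : ∀ s ∈ Icc a b, G.exp p (w s) = c s) : G.length c a b ≤ G.radius p (w b) := by
  rw [length_eq_integral_speed]
  by_cases hint : IntervalIntegrable (G.speed c) volume a b
  · have := intervalIntegral.integral_le_sub_of_hasDeriv_right_of_le h.lt.le h.continuousOn_radius
      (fun s hs => h.hasDerivWithinAt_radius hU hs)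
      ((intervalIntegrable_iff_integrableOn_Icc_of_le h.lt.le).1 hint)
      (fun s hs => h.speed_le hU hc hs)
    rwa [h.radius_zero, sub_zero] at this
  -- The integral of a non-integrable speed is 0 by default, so the bound holds trivially.
  · rw [intervalIntegral.integral_undef hint]
    exact Real.sqrt_nonneg _

theorem eq_smul_of_length_eq (hU : G.IsNormalNeighborhood p V U)
    (h : G.IsTimelikeLift p V w a b) (hc : ∀ s ∈ Icc a b, G.exp p (w s) = c s)
    (hL : G.length c a b = G.radius p (w b)) {s : ℝ} (hs : s ∈ Icc a b) :
    w s = (G.radius p (w s) / G.radius p (w b)) • w b := by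
  refine h.eq_smul_of_ae_radial hU ?_ hs
  have hb := h.radius_pos hU ⟨h.lt, le_rfl⟩
  rw [length_eq_integral_speed] at hL
  have hint : IntervalIntegrable (G.speed c) volume a b := by
    by_contra hint
    rw [intervalIntegral.integral_undef hint] at hL
    exact hb.ne hL
  have hint' := h.intervalIntegrable_radius_deriv hU le_rfl h.lt.le le_rfl
  -- A nonnegative integrand with zero integral vanishes almost everywhere. There the speed equals
  -- the positive derivative of the radius, which also excludes the default value 0.
  have hzero : ∫ s in a..b, (-derivWithin w (Ici s) s (G.sharp p (w s)) / G.radius p (w s) -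
      G.speed c s) = 0 := by
    rw [intervalIntegral.integral_sub hint' hint,
      h.integral_radius_deriv hU le_rfl h.lt.le le_rfl, h.radius_zero, hL, sub_zero, sub_self]
  have hnb : ∀ᵐ τ : ℝ, τ ≠ b := by simp [ae_iff]
  rw [intervalIntegral.integral_eq_zero_iff_of_le_of_nonneg_ae h.lt.le ?_ (hint'.sub hint),
    Filter.EventuallyEq, ae_restrict_iff' measurableSet_Ioc] at hzero
  · filter_upwards [hzero] with τ h1 hτ
    have h2 := sub_eq_zero.1 (h1 (Ioo_subset_Ioc_self hτ))
    have h3 := h.speed_cases hU hc hτ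
    rw [← h2] at h3
    exact hU.eq_smul_of_sqrt_form_eq (h.mem τ (Ioo_subset_Icc_self hτ))
      (h.neg hU τ (Ioo_subset_Ioc_self hτ)).1 (h.timelike_Ici (Ioo_subset_Ico_self hτ))
      (h3.resolve_left (h.radius_deriv_pos hU hτ).ne').symm
  · rw [Filter.EventuallyLE, ae_restrict_iff' measurableSet_Ioc]
    filter_upwards [hnb] with τ h1 hτ
    exact sub_nonneg.2 (h.speed_le hU hc ⟨hτ.1, hτ.2.lt_of_ne h1⟩)

end IsTimelikeLift

/-! ### Radial extremals as timelike curves -/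

namespace IsNormalNeighborhood

variable [T2Space M] {G : SubLorentzStructure E M} {p : M} {V : Set (E →L[ℝ] ℝ)} {U : Set M}

theorem radial_velocityWithin (hU : G.IsNormalNeighborhood p V U) {v : E →L[ℝ] ℝ} (hv : v ∈ V)
    {K : Set ℝ} {s : ℝ} (hs : s ∈ Icc (0 : ℝ) 1) (hK : UniqueDiffWithinAt ℝ K s) :
    (velocityWithin E (fun s : ℝ => G.exp p (s • v)) K s : E) = G.dexp p (s • v) v := by
  have hd : HasDerivAt (fun s : ℝ => s • v) v s := by
    simpa using (hasDerivAt_id s).smul_const v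
  rw [(hU.velocityWithin_lift (w := fun s : ℝ => s • v) hK (hU.smul_mem hv hs)
    hd.differentiableAt.differentiableWithinAt Filter.EventuallyEq.rfl rfl).2,
    hd.hasDerivWithinAt.derivWithin hK]

theorem isTimelikeCurve_radial (hU : G.IsNormalNeighborhood p V U) {v : E →L[ℝ] ℝ} (hv : v ∈ V)
    (hN : v (G.sharp p v) < 0) : G.IsTimelikeCurve (fun s : ℝ => G.exp p (s • v)) 0 1 := by
  refine ⟨zero_lt_one, 1, fun i => i, ⟨by simp, by simp, fun i _ => by simp⟩, ?_, by simp⟩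
  intro i hi
  obtain rfl : i = 0 := by omega
  simp only [Nat.cast_zero, zero_add, Nat.cast_one]
  refine ⟨?_, fun s hs => ?_⟩
  · refine hU.smooth.comp (ContDiff.contMDiff ?_).contMDiffOn fun s hs => hU.smul_mem hv hs
    exact contDiff_id.smul contDiff_const
  · have h1 : G.Timelike (G.exp p (s • v))
        (velocityWithin E (fun s : ℝ => G.exp p (s • v)) (Icc 0 1) s) := by
      rw [hU.radial_velocityWithin hv hs (uniqueDiffOn_Icc zero_lt_one s hs)]
      exact (hU.radial_velocity hv hN hs).1
    exact h1

theorem length_radial (hU : G.IsNormalNeighborhood p V U) {v : E →L[ℝ] ℝ} (hv : v ∈ V)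
    (hN : v (G.sharp p v) < 0) :
    G.length (fun s : ℝ => G.exp p (s • v)) 0 1 = G.radius p v := by
  rw [length_eq_integral_speed]
  have h1 : ∀ s ∈ uIcc (0 : ℝ) 1, G.speed (fun s : ℝ => G.exp p (s • v)) s = G.radius p v := by
    intro s hs
    rw [uIcc_of_le zero_le_one] at hs
    rw [speed, hU.radial_velocityWithin hv hs uniqueDiffWithinAt_univ,
      (hU.radial_velocity hv hN hs).2, abs_of_neg hN, radius]
  rw [intervalIntegral.integral_congr h1]
  simp

/-- The lift of a timelike curve in a normal neighbourhood. -/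
theorem exists_timelikeLift (hU : G.IsNormalNeighborhood p V U) {q : M} {c : ℝ → M} {a b : ℝ}
    (hc : G.IsTimelikeCurveIn U p q c a b) : ∃ w : ℝ → (E →L[ℝ] ℝ), IsPiecewiseSmooth w a b ∧
      G.IsTimelikeLift p V w a b ∧ ∀ s ∈ Icc a b, G.exp p (w s) = c s := by
  obtain ⟨w, h1, h2, h3⟩ := hU.exists_lift c a b hc.timelike hc.mapsTo hc.source
  exact ⟨w, h1, hU.isTimelikeLift hc.timelike h1 h2 h3, fun s hs => (h3 s hs).2⟩

end IsNormalNeighborhood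

end SubLorentzStructure

end

/-! ### The longest timelike curve -/

theorem mainTheorem3
    {E : Type u} [NormedAddCommGroup E] [NormedSpace ℝ E] [FiniteDimensional ℝ E]
    {M : Type v} [TopologicalSpace M] [T2Space M] [ChartedSpace E M] [IsManifold 𝓘(ℝ, E) ∞ M]
    (G : SubLorentzStructure E M) (p q : M) (V : Set (E →L[ℝ] ℝ)) (U : Set M)
    (hU : G.IsNormalNeighborhood p V U)
    (hα : ∃ (α : ℝ → M) (a b : ℝ), G.IsTimelikeCurveIn U p q α a b) :
    ∃ v ∈ V, ∃ Γ : ℝ → Σ x : M, CotangentSpace E x,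
      -- `σ = (Γ ·).1` on `[0, 1]` is the radial extremal segment from `p` to `q`
      (G.IsBiextremalOn Γ 0 1 ∧ Γ 0 = ⟨p, v⟩ ∧ (∀ s ∈ Icc (0 : ℝ) 1, (Γ s).1 = G.exp p (s • v)) ∧
        G.exp p v = q ∧ ∀ v' ∈ V, G.exp p v' = q → v' = v) ∧
      -- it is a timelike curve in `U`
      G.IsTimelikeCurveIn U p q (fun s => (Γ s).1) 0 1 ∧
      -- it is the longest one, and the only one of that length up to monotone reparametrization
      ∀ (β : ℝ → M) (a b : ℝ), G.IsTimelikeCurveIn U p q β a b →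
        G.length β a b ≤ G.length (fun s => (Γ s).1) 0 1 ∧
        (G.length β a b = G.length (fun s => (Γ s).1) 0 1 →
          ∃ h : ℝ → ℝ, IsPiecewiseSmooth h a b ∧ StrictMonoOn h (Icc a b) ∧ h a = 0 ∧ h b = 1 ∧
            ∀ s ∈ Icc a b, β s = (Γ (h s)).1) := by
  obtain ⟨α, a₀, b₀, hα⟩ := hα
  obtain ⟨w₀, -, hlift₀, hw₀⟩ := hU.exists_timelikeLift hα
  have hb₀ : b₀ ∈ Icc a₀ b₀ := right_mem_Icc.2 hlift₀.lt.le
  -- The end of the lift of the given curve; it is timelike by `IsTimelikeLift.neg`, so the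
  -- injectivity in the definition applies to it.
  set v := w₀ b₀ with hv
  have hvV : v ∈ V := hlift₀.mem b₀ hb₀
  have hN : v (G.sharp p v) < 0 := (hlift₀.neg hU b₀ ⟨hlift₀.lt, le_rfl⟩).1
  have hvq : G.exp p v = q := (hw₀ b₀ hb₀).trans hα.target
  have huniq : ∀ v' ∈ V, G.exp p v' = q → v' = v := fun v' hv' h =>
    hU.injective v hvV hN v' hv' (h.trans hvq.symm)
  obtain ⟨ξ, hξ, hξ0, hp⟩ := SubLorentzStructure.exists_momentum (hU.subset_expDomain hvV)
  refine ⟨v, hvV, fun s => ⟨G.exp p (s • v), ξ s⟩, ⟨hξ, ?_, fun _ _ => rfl, hvq, huniq⟩,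
    ⟨hU.isTimelikeCurve_radial hvV hN, fun s hs => hU.mapsTo (hU.smul_mem hvV hs), ?_, ?_⟩, ?_⟩
  · exact SubLorentzStructure.sigma_mk_congr (by rw [zero_smul, hp]) hξ0
  · simp only [zero_smul, hp]
  · simp only [one_smul, hvq]
  intro β a b hβ
  obtain ⟨w, hws, hlift, hw⟩ := hU.exists_timelikeLift hβ
  have hb : b ∈ Icc a b := right_mem_Icc.2 hlift.lt.le
  have hwb : w b = v := huniq _ (hlift.mem b hb) ((hw b hb).trans hβ.target)
  rw [hU.length_radial hvV hN, ← hwb]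
  refine ⟨hlift.length_le_radius hU hw, fun hL => ?_⟩
  have hrad := fun s (hs : s ∈ Icc a b) => hlift.eq_smul_of_length_eq hU hw hL hs
  have hpos : 0 < G.radius p (w b) := hlift.radius_pos hU ⟨hlift.lt, le_rfl⟩
  have hh : ∀ s ∈ Icc a b, w s (G.sharp p (w b)) / w b (G.sharp p (w b)) =
      G.radius p (w s) / G.radius p (w b) := by
    intro s hs
    have hN' : w b (G.sharp p (w b)) ≠ 0 := by rw [hwb]; exact hN.ne
    rw [div_eq_iff hN']
    conv_lhs => rw [hrad s hs]
    simp
  -- On the radial lift this equals r(w s) / r(w b), but it is linear in w s and hence piecewise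
  -- smooth up to s = a, where the square root in the radius is singular.
  refine ⟨fun s => w s (G.sharp p (w b)) / w b (G.sharp p (w b)), ?_, ?_, ?_, ?_, ?_⟩
  · obtain ⟨N, t, ht, hsm⟩ := hws
    exact ⟨N, t, ht, fun i hi => ((hsm i hi).clm_apply contDiffOn_const).div_const _⟩
  · intro x hx y hy hxy
    simp only [hh x hx, hh y hy]
    exact div_lt_div_of_pos_right (hlift.strictMonoOn_radius hU hx hy hxy) hpos
  · simp [hlift.zero]
  · simp only [hh b hb, div_self hpos.ne']
  · intro s hs
    simp only [hh s hs]
    rw [← hw s hs, ← hrad s hs]
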